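/- A weighted graph is a finite simple undirected graph $G=(V,E)$ together with a weight function $w\colon E\to\mathbb{Q}$ with $w(e)>0$ for every $e\in E$ ($G$ need not be connected). A $k$-cut of $G$ is a set of edges $F\subseteq E$ such that $(V,E\setminus F)$ has at least $k$ connected components. A minimum $k$-cut is a $k$-cut whose total weight $\sum_{e\in F}w(e)$ is least among all $k$-cuts of $G$. **Corollary (Number of Minimum $k$-cuts).** For every integer $k\ge 2$ there is a constant $C=C(k)>0$ such that every weighted graph on $n\ge 2$ vertices has at most $$ n^{k}\cdot 2^{\,C(\ln\ln n)^2}$$ distinct minimum $k$-cuts. -/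

import Mathlib

/-- A `k`-cut of a graph: a set of edges whose deletion leaves at least `k` connected components. -/
def IsKCut {V : Type*} (G : SimpleGraph V) (k : ℕ) (F : Finset (Sym2 V)) : Prop :=
  (F : Set (Sym2 V)) ⊆ G.edgeSet ∧
    k ≤ Nat.card (G.deleteEdges (F : Set (Sym2 V))).ConnectedComponent

/-- A minimum `k`-cut: a `k`-cut whose total weight is least among all `k`-cuts.
Only the values of `w` on edges of `G` matter. -/
def IsMinKCut {V : Type*} (G : SimpleGraph V) (w : Sym2 V → ℚ) (k : ℕ)
    (F : Finset (Sym2 V)) : Prop :=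
  IsKCut G k F ∧ ∀ F' : Finset (Sym2 V), IsKCut G k F' → ∑ e ∈ F, w e ≤ ∑ e ∈ F', w e

/-! Let λ be the minimum weight of a k-cut and μ = λ/k, and call a vertex set small if its boundary
weighs less than 2μ. For fixed k there are O(n log n) small sets (`card_smallSets_le`), and the
number of minimum k-cuts is O((n + k·#small)^k) (`KCutBound.card_le_of_smallSets`). The product is
n^k times a power of log n, which 2^(C (ln ln n)²) absorbs because |ln ln n| is bounded away from 0
over integers n ≥ 2.

Small sets: greedily splitting classes of a partition at cost below θ must stop before k classes
appear, leaving a "stuck" partition. A small set splits at most one class X of a partition stuck at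
level kμ/(k-1), so up to 4^k patterns it is determined by its trace on X. An antichain of such sets,
all containing v and missing s, has bounded size: a large antichain has a large subfamily for which
the weight between the common interior and the common exterior is higher by μ/(k-1), yet this weight
stays below 2μ (`IsSmallAntichain.step`). Layering by the size of the trace then gives a harmonic
sum.

Cuts: this is random contraction in Karger's style, written as an induction without probability. For
a fixed cut F, the potential Φ of a contracted graph is its number of classes, minus 2k³+k, plus k
times the number of surviving small sets with enough boundary outside F. Contractions avoiding F
lower Φ at rate at least μΦ (`KCutBound.potential_drift`). By Bernoulli's inequality the sum of
Φ^(-k) over all cuts F stays bounded (`KCutBound.sum_potential_le`), while initially Φ ≤ n +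
k·#small. -/

/-- A finite multigraph with positive real edge weights. -/
structure WGraph (V ι : Type*) where
  fst : ι → V
  snd : ι → V
  w : ι → ℝ
  w_pos : ∀ e, 0 < w e

/-! ### Edge weights and stuck partitions. -/

namespace WGraph

variable {V ι : Type*} [Fintype ι] (G : WGraph V ι)

open Classical in
/-- The total weight of the edges satisfying `p`. -/
noncomputable def mass (p : ι → Prop) : ℝ := ∑ e, if p e then G.w e else 0

/-- The edge `e` joins two different classes of the labelling `g`. -/
def Cross {α : Type*} (g : V → α) (e : ι) : Prop := g (G.fst e) ≠ g (G.snd e)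

/-- The edge `e` has exactly one endpoint in `D`. -/
def Sep (D : Finset V) (e : ι) : Prop := ¬ (G.fst e ∈ D ↔ G.snd e ∈ D)

/-- The edge `e` joins `X` to `Y`. -/
def Btw (X Y : Set V) (e : ι) : Prop :=
  (G.fst e ∈ X ∧ G.snd e ∈ Y) ∨ (G.fst e ∈ Y ∧ G.snd e ∈ X)

lemma mass_nonneg (p : ι → Prop) : 0 ≤ G.mass p :=
  Finset.sum_nonneg fun e _ => by split_ifs; exacts [(G.w_pos e).le, le_rfl]

lemma mass_mono {p q : ι → Prop} (h : ∀ e, p e → q e) : G.mass p ≤ G.mass q := by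
  refine Finset.sum_le_sum fun e _ => ?_
  have := G.w_pos e
  have := h e
  split_ifs <;> first | tauto | linarith

lemma mass_congr {p q : ι → Prop} (h : ∀ e, p e ↔ q e) : G.mass p = G.mass q :=
  congrArg G.mass (funext fun e => propext (h e))

lemma mass_le_add {p q r : ι → Prop} (h : ∀ e, p e → q e ∨ r e) :
    G.mass p ≤ G.mass q + G.mass r := by
  unfold mass
  rw [← Finset.sum_add_distrib]
  refine Finset.sum_le_sum fun e _ => ?_
  have := G.w_pos e
  have := h e
  split_ifs <;> first | tauto | linarith

lemma mass_add_le {p q r : ι → Prop} (hp : ∀ e, p e → r e) (hq : ∀ e, q e → r e)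
    (hpq : ∀ e, p e → ¬ q e) : G.mass p + G.mass q ≤ G.mass r := by
  unfold mass
  rw [← Finset.sum_add_distrib]
  refine Finset.sum_le_sum fun e _ => ?_
  have := G.w_pos e
  have := hp e
  have := hq e
  have := hpq e
  split_ifs <;> first | tauto | linarith

lemma mass_sep_compl [Fintype V] [DecidableEq V] (D : Finset V) :
    G.mass (G.Sep Dᶜ) = G.mass (G.Sep D) :=
  G.mass_congr fun e => by simp only [Sep, Finset.mem_compl]; tauto

/-- An edge between K and P lies on both boundaries but not on that of the union, hence the factor
2. -/
lemma mass_sep_add_le [DecidableEq V] {K P : Finset V} (h : Disjoint K P) :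
    G.mass (G.Sep K) + G.mass (G.Sep P) ≤
      G.mass (G.Sep (K ∪ P)) + 2 * G.mass (G.Btw K P) := by
  unfold mass
  rw [← Finset.sum_add_distrib, Finset.mul_sum, ← Finset.sum_add_distrib]
  refine Finset.sum_le_sum fun e _ => ?_
  have hw := G.w_pos e
  have h1 : G.fst e ∈ K → G.fst e ∉ P := fun h' => Finset.disjoint_left.1 h h'
  have h2 : G.snd e ∈ K → G.snd e ∉ P := fun h' => Finset.disjoint_left.1 h h'
  by_cases a : G.fst e ∈ K <;> by_cases b : G.snd e ∈ K <;> by_cases c : G.fst e ∈ P <;>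
    by_cases d : G.snd e ∈ P <;> simp_all [Sep, Btw] <;> linarith

/-- Every set that splits a class of `g` has weight at least `θ` inside that class. -/
def Stuck (θ : ℝ) (g : V → ℕ) : Prop :=
  ∀ (x : ℕ) (D : Finset V), (∃ u, g u = x ∧ u ∈ D) → (∃ u, g u = x ∧ u ∉ D) →
    θ ≤ G.mass fun e => g (G.fst e) = x ∧ g (G.snd e) = x ∧ G.Sep D e

variable {G} in
lemma Stuck.le_mass_sep {θ : ℝ} {g : V → ℕ} (h : G.Stuck θ g) {x : ℕ} {D : Finset V}
    (h₁ : ∃ u, g u = x ∧ u ∈ D) (h₂ : ∃ u, g u = x ∧ u ∉ D) : θ ≤ G.mass (G.Sep D) :=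
  (h x D h₁ h₂).trans (G.mass_mono fun _ he => he.2.2)

variable {G} in
-- Edges inside different classes are disjoint, so splitting two classes would already cost 2θ.
lemma Stuck.unique_split {θ : ℝ} {g : V → ℕ} (h : G.Stuck θ g) {D : Finset V}
    (hD : G.mass (G.Sep D) < 2 * θ) {x y : ℕ}
    (hx₁ : ∃ u, g u = x ∧ u ∈ D) (hx₂ : ∃ u, g u = x ∧ u ∉ D)
    (hy₁ : ∃ u, g u = y ∧ u ∈ D) (hy₂ : ∃ u, g u = y ∧ u ∉ D) : x = y := by
  by_contra hxy
  have := G.mass_add_le (r := G.Sep D)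
    (p := fun e => g (G.fst e) = x ∧ g (G.snd e) = x ∧ G.Sep D e)
    (q := fun e => g (G.fst e) = y ∧ g (G.snd e) = y ∧ G.Sep D e)
    (fun _ h => h.2.2) (fun _ h => h.2.2) (fun e h h' => hxy (h.1.symm.trans h'.1))
  have := h x D hx₁ hx₂
  have := h y D hy₁ hy₂
  linarith

variable [Fintype V]

lemma exists_refinement_of_not_stuck {θ : ℝ} {g : V → ℕ} (h : ¬ G.Stuck θ g) :
    ∃ g' : V → ℕ, (∀ u v, g' u = g' v → g u = g v) ∧
      (Finset.univ.image g').card = (Finset.univ.image g).card + 1 ∧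
      G.mass (G.Cross g') < G.mass (G.Cross g) + θ := by
  classical
  unfold Stuck at h
  push Not at h
  obtain ⟨x, D, ⟨u₁, hu₁, hD₁⟩, ⟨u₂, hu₂, hD₂⟩, hlt⟩ := h
  -- A label unused by `g`, so that relabelling the part of class x inside D adds exactly one class.
  set M := Finset.univ.sup g + 1 with hM
  have hgM : ∀ v, g v ≠ M := fun v => by
    have : g v ≤ Finset.univ.sup g := Finset.le_sup (Finset.mem_univ v)
    omega
  refine ⟨fun v => if g v = x ∧ v ∈ D then M else g v, ?_, ?_, ?_⟩
  · intro u v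
    have := hgM u
    have := hgM v
    dsimp only
    split_ifs with h1 h2 h2
    · intro _; rw [h1.1, h2.1]
    · intro h; exact absurd h.symm ‹_›
    · intro h; exact absurd h ‹_›
    · exact id
  · have : Finset.univ.image (fun v => if g v = x ∧ v ∈ D then M else g v) =
        insert M (Finset.univ.image g) := by
      ext y
      simp only [Finset.mem_image, Finset.mem_univ, true_and, Finset.mem_insert]
      constructor
      · rintro ⟨v, rfl⟩
        split_ifs
        · exact Or.inl rfl
        · exact Or.inr ⟨v, rfl⟩
      · rintro (rfl | ⟨v, rfl⟩)
        · exact ⟨u₁, if_pos ⟨hu₁, hD₁⟩⟩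
        · by_cases hv : g v = x ∧ v ∈ D
          · exact ⟨u₂, by rw [if_neg fun h => hD₂ h.2, hu₂, hv.1]⟩
          · exact ⟨v, if_neg hv⟩
    rw [this, Finset.card_insert_of_notMem]
    simpa using hgM
  · refine lt_of_le_of_lt (G.mass_le_add (q := G.Cross g)
      (r := fun e => g (G.fst e) = x ∧ g (G.snd e) = x ∧ G.Sep D e) fun e he => ?_)
      (by linarith)
    by_contra hcon
    push Not at hcon
    obtain ⟨h1, h2⟩ := hcon
    unfold Cross at h1 he
    unfold Sep at h2
    push Not at h1
    apply he
    simp only [h1]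
    by_cases hx : g (G.snd e) = x
    · have := h2 (h1.trans hx) hx
      push Not at this
      simp only [hx, true_and, this]
    · simp [hx]

/-- The hypothesis that every partition into at least `k` classes has weight at least `lam`. -/
def KCutBound (k : ℕ) (lam : ℝ) : Prop :=
  ∀ g : V → ℕ, k ≤ (Finset.univ.image g).card → lam ≤ G.mass (G.Cross g)

variable {G}

/-- While the partition is not stuck, a split adds one class at cost below θ and preserves the
budget α + (number of classes)·θ. Reaching k classes would give a k-way partition of weight below α
+ kθ ≤ `lam`. -/
lemma KCutBound.exists_stuck {k : ℕ} {lam α θ : ℝ} (hP : G.KCutBound k lam)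
    (hα : α + k * θ ≤ lam) (g : V → ℕ) (hg : (Finset.univ.image g).card < k)
    (hc : G.mass (G.Cross g) ≤ α + (Finset.univ.image g).card * θ) :
    ∃ g' : V → ℕ, (Finset.univ.image g').card < k ∧ (∀ u v, g' u = g' v → g u = g v) ∧
      G.Stuck θ g' := by
  obtain ⟨d, hd⟩ : ∃ d, k = (Finset.univ.image g).card + d := ⟨_, (Nat.add_sub_of_le hg.le).symm⟩
  induction d generalizing g with
  | zero => omega
  | succ d ih =>
    by_cases hs : G.Stuck θ g
    · exact ⟨g, hg, fun _ _ h => h, hs⟩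
    · obtain ⟨g₁, href, hcard, hlt⟩ := G.exists_refinement_of_not_stuck hs
      have hc₁ : G.mass (G.Cross g₁) < α + (Finset.univ.image g₁).card * θ := by
        rw [hcard]; push_cast; linarith
      have hk : (Finset.univ.image g₁).card < k := by
        by_contra hk
        have h1 := hP g₁ (not_lt.1 hk)
        have h2 : (Finset.univ.image g₁).card = k := by omega
        rw [h2] at hc₁
        linarith
      obtain ⟨g₂, h1, h2, h3⟩ := ih g₁ hk hc₁.le (by omega)
      exact ⟨g₂, h1, fun u v h => href u v (h2 u v h), h3⟩

lemma KCutBound.exists_stuck_of_small {k : ℕ} {μ : ℝ} (hk : 2 ≤ k) (hμ : 0 < μ)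
    (hP : G.KCutBound k (k * μ)) {B : Finset V} (hB : G.mass (G.Sep B) < 2 * μ)
    (h₁ : ∃ u, u ∈ B) (h₂ : ∃ u, u ∉ B) :
    ∃ g : V → ℕ, (Finset.univ.image g).card < k ∧ (∀ u v, g u = g v → (u ∈ B ↔ v ∈ B)) ∧
      G.Stuck μ g := by
  classical
  set g₀ : V → ℕ := fun v => if v ∈ B then 0 else 1 with hg₀
  have himg : Finset.univ.image g₀ = {0, 1} := by
    obtain ⟨u₁, h₁⟩ := h₁
    obtain ⟨u₂, h₂⟩ := h₂
    ext y
    simp only [Finset.mem_image, Finset.mem_univ, true_and, Finset.mem_insert,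
      Finset.mem_singleton]
    constructor
    · rintro ⟨v, rfl⟩
      simp only [hg₀]
      split_ifs <;> simp
    · rintro (rfl | rfl)
      exacts [⟨u₁, if_pos h₁⟩, ⟨u₂, if_neg h₂⟩]
  have hcard : (Finset.univ.image g₀).card = 2 := by rw [himg]; rfl
  have hcost : G.mass (G.Cross g₀) ≤ G.mass (G.Sep B) := G.mass_mono fun e he hiff => he (by
    simp only [hg₀, hiff])
  have hk2 : (2 : ℝ) ≤ k := by exact_mod_cast hk
  have hlt : (Finset.univ.image g₀).card < k := by
    by_contra hlt
    have := hP g₀ (not_lt.1 hlt)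
    nlinarith
  obtain ⟨g, hg, href, hs⟩ := hP.exists_stuck (α := 0) (θ := μ) (by linarith) g₀ hlt (by
    rw [hcard]; push_cast; linarith)
  refine ⟨g, hg, fun u v huv => ?_, hs⟩
  have := href u v huv
  simp only [hg₀] at this
  split_ifs at this <;> simp_all

end WGraph

/-! ### Antichains of small sets. -/

namespace WGraph

variable {V ι : Type*} [Fintype ι] (G : WGraph V ι)

/-- The weight between the points common to all members of `𝒞` and the points in none of them. -/
noncomputable def coreWeight (𝒞 : Finset (Finset V)) : ℝ :=
  G.mass (G.Btw {v | ∀ B ∈ 𝒞, v ∈ B} {v | ∀ B ∈ 𝒞, v ∉ B})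

lemma coreWeight_le {𝒞 : Finset (Finset V)} {B : Finset V} (hB : B ∈ 𝒞) :
    G.coreWeight 𝒞 ≤ G.mass (G.Sep B) := by
  refine G.mass_mono fun e he => ?_
  rcases he with ⟨h1, h2⟩ | ⟨h1, h2⟩
  · have := h1 B hB
    have := h2 B hB
    unfold Sep; tauto
  · have := h1 B hB
    have := h2 B hB
    unfold Sep; tauto

/-- Edges between K and P are new core edges: the subfamily puts K and P on opposite sides, whereas
in the larger family every point of P lies in some members and outside others. -/
lemma coreWeight_add_le {𝒞 𝒞' : Finset (Finset V)} (hsub : 𝒞' ⊆ 𝒞) {K P : Set V}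
    (hKP : (∀ D ∈ 𝒞', K ⊆ D ∧ Disjoint P (D : Set V)) ∨
      (∀ D ∈ 𝒞', P ⊆ D ∧ Disjoint K (D : Set V)))
    (hP : ∀ u ∈ P, ∃ B ∈ 𝒞, ∃ D ∈ 𝒞, u ∈ B ∧ u ∉ D) :
    G.coreWeight 𝒞 + G.mass (G.Btw K P) ≤ G.coreWeight 𝒞' := by
  refine G.mass_add_le (fun e he => ?_) (fun e he => ?_) (fun e he he' => ?_)
  · rcases he with ⟨h1, h2⟩ | ⟨h1, h2⟩
    · exact Or.inl ⟨fun B hB => h1 B (hsub hB), fun B hB => h2 B (hsub hB)⟩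
    · exact Or.inr ⟨fun B hB => h1 B (hsub hB), fun B hB => h2 B (hsub hB)⟩
  · rcases hKP with h | h
    · have hK : K ⊆ {v | ∀ B ∈ 𝒞', v ∈ B} := fun u hu B hB => (h B hB).1 hu
      have hP : P ⊆ {v | ∀ B ∈ 𝒞', v ∉ B} := fun u hu B hB =>
        Set.disjoint_left.1 (h B hB).2 hu
      exact he.imp (fun h => ⟨hK h.1, hP h.2⟩) (fun h => ⟨hP h.1, hK h.2⟩)
    · have hK : P ⊆ {v | ∀ B ∈ 𝒞', v ∈ B} := fun u hu B hB => (h B hB).1 hu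
      have hP : K ⊆ {v | ∀ B ∈ 𝒞', v ∉ B} := fun u hu B hB =>
        Set.disjoint_left.1 (h B hB).2 hu
      exact (he.imp (fun h => ⟨hP h.1, hK h.2⟩) (fun h => ⟨hK h.1, hP h.2⟩)).symm
  · have key : ∀ u ∈ P, u ∉ {v | ∀ B ∈ 𝒞, v ∈ B} ∧ u ∉ {v | ∀ B ∈ 𝒞, v ∉ B} := by
      intro u hu
      obtain ⟨B, hB, D, hD, h1, h2⟩ := hP u hu
      exact ⟨fun h => h2 (h D hD), fun h => h B hB h1⟩
    have k1 := key (G.fst e)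
    have k2 := key (G.snd e)
    unfold Btw at he he'
    tauto

variable [Fintype V] {G}

/-- The pair of images records which classes meet D and which meet its complement. This signature
determines D outside the classes that D splits. -/
lemma agree_of_image_eq [DecidableEq V] {g : V → ℕ} {D D' : Finset V}
    (h₁ : D.image g = D'.image g) (h₂ : Dᶜ.image g = D'ᶜ.image g)
    {u : V} (hu : ¬ (g u ∈ D.image g ∧ g u ∈ Dᶜ.image g)) : u ∈ D ↔ u ∈ D' := by
  constructor
  · intro h
    by_contra h'
    refine hu ⟨Finset.mem_image_of_mem g h, ?_⟩
    rw [h₂]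
    exact Finset.mem_image_of_mem g (Finset.mem_compl.2 h')
  · intro h'
    by_contra h
    refine hu ⟨?_, Finset.mem_image_of_mem g (Finset.mem_compl.2 h)⟩
    rw [h₁]
    exact Finset.mem_image_of_mem g h'

lemma card_signatures_le [DecidableEq V] {k : ℕ} {g : V → ℕ}
    (hg : (Finset.univ.image g).card < k) :
    ((Finset.univ.image g).powerset ×ˢ (Finset.univ.image g).powerset).card ≤ 4 ^ k := by
  rw [Finset.card_product, Finset.card_powerset, ← mul_pow]
  exact Nat.pow_le_pow_right (by norm_num) hg.le

lemma signature_mem [DecidableEq V] (g : V → ℕ) (D : Finset V) :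
    (D.image g, Dᶜ.image g) ∈
      (Finset.univ.image g).powerset ×ˢ (Finset.univ.image g).powerset := by
  simp only [Finset.mem_product, Finset.mem_powerset]
  exact ⟨Finset.image_subset_image (Finset.subset_univ _),
    Finset.image_subset_image (Finset.subset_univ _)⟩

/-- Sets of weight less than `2 * μ` that contain `v`, avoid `s`, agree outside `X`, and are
pairwise incomparable. -/
structure IsSmallAntichain (G : WGraph V ι) (μ : ℝ) (X : Set V) (s v : V)
    (𝒞 : Finset (Finset V)) : Prop where
  small : ∀ B ∈ 𝒞, G.mass (G.Sep B) < 2 * μ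
  notMem : ∀ B ∈ 𝒞, s ∉ B
  mem : ∀ B ∈ 𝒞, v ∈ B
  agree : ∀ B ∈ 𝒞, ∀ D ∈ 𝒞, ∀ u ∉ X, (u ∈ B ↔ u ∈ D)
  incomp : ∀ B ∈ 𝒞, ∀ D ∈ 𝒞, B ≠ D → ∃ u ∈ B, u ∉ D

omit [Fintype V] in
lemma IsSmallAntichain.subset {μ : ℝ} {X : Set V} {s v : V} {𝒞 𝒞' : Finset (Finset V)}
    (h : IsSmallAntichain G μ X s v 𝒞) (hsub : 𝒞' ⊆ 𝒞) : IsSmallAntichain G μ X s v 𝒞' where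
  small B hB := h.small B (hsub hB)
  notMem B hB := h.notMem B (hsub hB)
  mem B hB := h.mem B (hsub hB)
  agree B hB D hD := h.agree B (hsub hB) D (hsub hD)
  incomp B hB D hD := h.incomp B (hsub hB) D (hsub hD)

/-- Fix a member B and a μ-stuck refinement of {B, Bᶜ}. Members with a common signature vary within
a single class, which lies on one side of B. On the other side they cut B or Bᶜ into the same two
pieces K and P; each piece splits X and so has boundary at least θ, while K ∪ P has boundary below
2μ. Hence K and P are joined by weight at least θ - μ, which is added to the core. -/
lemma IsSmallAntichain.step {k : ℕ} {μ θ : ℝ} (hk : 2 ≤ k) (hμ : 0 < μ)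
    (hP : G.KCutBound k (k * μ)) {X : Set V}
    (hX : ∀ D : Finset V, (∃ u ∈ X, u ∈ D) → (∃ u ∈ X, u ∉ D) → θ ≤ G.mass (G.Sep D))
    {s v : V} (hs : s ∈ X) (hv : v ∈ X) {𝒞 : Finset (Finset V)}
    (h𝒞 : IsSmallAntichain G μ X s v 𝒞) {m : ℕ} (hm : 1 ≤ m) (hcard : 4 ^ k * m + 1 ≤ 𝒞.card) :
    ∃ 𝒞' ⊆ 𝒞, m ≤ 𝒞'.card ∧ G.coreWeight 𝒞 + (θ - μ) ≤ G.coreWeight 𝒞' := by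
  classical
  obtain ⟨B, hB⟩ : 𝒞.Nonempty := Finset.card_pos.1 (by omega)
  obtain ⟨g, hgk, hgB, hstuck⟩ := hP.exists_stuck_of_small hk hμ (h𝒞.small B hB)
    ⟨v, h𝒞.mem B hB⟩ ⟨s, h𝒞.notMem B hB⟩
  obtain ⟨⟨S₁, S₂⟩, -, hfib⟩ := Finset.exists_le_card_fiber_of_mul_le_card_of_maps_to
    (s := 𝒞.erase B) (f := fun D => (D.image g, Dᶜ.image g))
    (n := m) (fun D _ => signature_mem g D)
    ⟨_, signature_mem g ∅⟩ (by
      rw [Finset.card_erase_of_mem hB]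
      calc _ ≤ 4 ^ k * m := Nat.mul_le_mul_right _ (card_signatures_le hgk)
        _ ≤ _ := by omega)
  set 𝒞' := {D ∈ 𝒞.erase B | (D.image g, Dᶜ.image g) = (S₁, S₂)} with h𝒞'
  have hsub : 𝒞' ⊆ 𝒞 := (Finset.filter_subset _ _).trans (Finset.erase_subset _ _)
  have hmem : ∀ D ∈ 𝒞', D ∈ 𝒞 ∧ D ≠ B ∧ D.image g = S₁ ∧ Dᶜ.image g = S₂ := by
    intro D hD
    simp only [h𝒞', Finset.mem_filter, Finset.mem_erase, Prod.mk.injEq] at hD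
    tauto
  obtain ⟨D₀, hD₀⟩ : 𝒞'.Nonempty := Finset.card_pos.1 (by omega)
  obtain ⟨hD₀𝒞, hD₀B, hS₁, hS₂⟩ := hmem D₀ hD₀
  -- The region where members of the fibre may differ. It is at most one class, because `D₀` is too
  -- light to split two.
  set Z : Set V := {u | g u ∈ S₁ ∧ g u ∈ S₂} with hZ
  have hagree : ∀ D ∈ 𝒞', ∀ u ∉ Z, (u ∈ D ↔ u ∈ D₀) := by
    intro D hD u hu
    obtain ⟨-, -, h1, h2⟩ := hmem D hD
    refine agree_of_image_eq (g := g) (h1.trans hS₁.symm) (h2.trans hS₂.symm) ?_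
    rw [h1, h2]
    exact hu
  have hsplit : ∀ y ∈ S₁, y ∈ S₂ → (∃ u, g u = y ∧ u ∈ D₀) ∧ ∃ u, g u = y ∧ u ∉ D₀ := by
    intro y h1 h2
    rw [← hS₁] at h1
    rw [← hS₂] at h2
    obtain ⟨u, hu, rfl⟩ := Finset.mem_image.1 h1
    obtain ⟨u', hu', h'⟩ := Finset.mem_image.1 h2
    exact ⟨⟨u, rfl, hu⟩, ⟨u', h', Finset.mem_compl.1 hu'⟩⟩
  have hconst : ∀ u ∈ Z, ∀ u' ∈ Z, (u ∈ B ↔ u' ∈ B) := by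
    intro u hu u' hu'
    obtain ⟨a1, a2⟩ := hsplit _ hu.1 hu.2
    obtain ⟨b1, b2⟩ := hsplit _ hu'.1 hu'.2
    exact hgB u u' (hstuck.unique_split (h𝒞.small D₀ hD₀𝒞) a1 a2 b1 b2)
  have hweights : ∀ K P : Finset V, Disjoint K P →
      G.mass (G.Sep (K ∪ P)) = G.mass (G.Sep B) → (∃ u ∈ X, u ∈ K) → (∃ u ∈ X, u ∉ K) →
      (∃ u ∈ X, u ∈ P) → (∃ u ∈ X, u ∉ P) → θ - μ ≤ G.mass (G.Btw K P) := by
    intro K P hdis heq k1 k2 p1 p2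
    have h1 := G.mass_sep_add_le hdis
    have h2 := hX K k1 k2
    have h3 := hX P p1 p2
    have h4 := h𝒞.small B hB
    rw [heq] at h1
    linarith
  have hinX : ∀ u, ¬ (u ∈ B ↔ u ∈ D₀) → u ∈ X := fun u hu => by
    by_contra h
    exact hu (h𝒞.agree B hB D₀ hD₀𝒞 u h)
  have hsB := h𝒞.notMem B hB
  have hsD := h𝒞.notMem D₀ hD₀𝒞
  have hvB := h𝒞.mem B hB
  have hvD := h𝒞.mem D₀ hD₀𝒞
  refine ⟨𝒞', hsub, hfib, ?_⟩
  -- If Z meets B then Z ⊆ B and the members agree outside B; otherwise they agree inside B.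
  by_cases hZB : ∃ u ∈ Z, u ∈ B
  · obtain ⟨z, hzZ, hzB⟩ := hZB
    have hag : ∀ D ∈ 𝒞', ∀ u ∉ B, (u ∈ D ↔ u ∈ D₀) := fun D hD u hu =>
      hagree D hD u fun huZ => hu ((hconst u huZ z hzZ).2 hzB)
    obtain ⟨p, hpD, hpB⟩ := h𝒞.incomp D₀ hD₀𝒞 B hB hD₀B
    have hw := hweights (B ∪ D₀)ᶜ (D₀ \ B)
      (Finset.disjoint_left.2 fun u hu hu' => by
        simp only [Finset.mem_compl, Finset.mem_union, Finset.mem_sdiff] at hu hu'; tauto)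
      (by
        rw [← G.mass_sep_compl B]
        congr 2
        ext u
        simp only [Finset.mem_compl, Finset.mem_union, Finset.mem_sdiff]; tauto)
      ⟨s, hs, by simp [hsB, hsD]⟩ ⟨v, hv, by simp [hvB]⟩
      ⟨p, hinX p (by tauto), by simp [hpB, hpD]⟩ ⟨s, hs, by simp [hsD]⟩
    refine (add_le_add_right hw _).trans (G.coreWeight_add_le hsub (Or.inr fun D hD => ⟨?_, ?_⟩) ?_)
    · intro u hu
      simp only [Finset.coe_sdiff, Set.mem_sdiff, Finset.mem_coe] at hu
      exact (hag D hD u hu.2).2 hu.1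
    · rw [Set.disjoint_left]
      intro u hu hu'
      simp only [Finset.mem_coe, Finset.mem_compl, Finset.mem_union, not_or] at hu hu'
      exact hu.2 ((hag D hD u hu.1).1 hu')
    · intro u hu
      simp only [Finset.coe_sdiff, Set.mem_sdiff, Finset.mem_coe] at hu
      exact ⟨D₀, hD₀𝒞, B, hB, hu⟩
  · push Not at hZB
    have hag : ∀ D ∈ 𝒞', ∀ u ∈ B, (u ∈ D ↔ u ∈ D₀) := fun D hD u hu =>
      hagree D hD u fun huZ => hZB u huZ hu
    obtain ⟨p, hpB, hpD⟩ := h𝒞.incomp B hB D₀ hD₀𝒞 (Ne.symm hD₀B)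
    have hw := hweights (B ∩ D₀) (B \ D₀)
      (Finset.disjoint_left.2 fun u hu hu' => by
        simp only [Finset.mem_inter, Finset.mem_sdiff] at hu hu'; tauto)
      (by
        congr 2
        ext u
        simp only [Finset.mem_inter, Finset.mem_union, Finset.mem_sdiff]; tauto)
      ⟨v, hv, by simp [hvB, hvD]⟩ ⟨s, hs, by simp [hsB]⟩
      ⟨p, hinX p (by tauto), by simp [hpB, hpD]⟩ ⟨s, hs, by simp [hsB]⟩
    refine (add_le_add_right hw _).trans (G.coreWeight_add_le hsub (Or.inl fun D hD => ⟨?_, ?_⟩) ?_)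
    · intro u hu
      simp only [Finset.coe_inter, Set.mem_inter_iff, Finset.mem_coe] at hu
      exact (hag D hD u hu.1).2 hu.2
    · rw [Set.disjoint_left]
      intro u hu hu'
      simp only [Finset.coe_sdiff, Set.mem_sdiff, Finset.mem_coe] at hu hu'
      exact hu.2 ((hag D hD u hu.1).1 hu')
    · intro u hu
      simp only [Finset.coe_sdiff, Set.mem_sdiff, Finset.mem_coe] at hu
      exact ⟨B, hB, D₀, hD₀𝒞, hu⟩

/-- Each round costs a factor 4^k + 1 in size, since (4^k + 1)·m ≥ 4^k·m + 1 for m ≥ 1. -/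
lemma IsSmallAntichain.iterate {k : ℕ} {μ θ : ℝ} (hk : 2 ≤ k) (hμ : 0 < μ)
    (hP : G.KCutBound k (k * μ)) {X : Set V}
    (hX : ∀ D : Finset V, (∃ u ∈ X, u ∈ D) → (∃ u ∈ X, u ∉ D) → θ ≤ G.mass (G.Sep D))
    {s v : V} (hs : s ∈ X) (hv : v ∈ X) (j : ℕ) {𝒞 : Finset (Finset V)}
    (h𝒞 : IsSmallAntichain G μ X s v 𝒞) (hcard : (4 ^ k + 1) ^ j ≤ 𝒞.card) :
    ∃ 𝒞' ⊆ 𝒞, 𝒞'.Nonempty ∧ G.coreWeight 𝒞 + j * (θ - μ) ≤ G.coreWeight 𝒞' := by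
  induction j generalizing 𝒞 with
  | zero => exact ⟨𝒞, subset_rfl, Finset.card_pos.1 (by simpa using hcard), by simp⟩
  | succ j ih =>
    have hpos : 1 ≤ (4 ^ k + 1) ^ j := Nat.one_le_pow _ _ (by positivity)
    obtain ⟨𝒞₁, hsub₁, hc₁, hw₁⟩ := h𝒞.step hk hμ hP hX hs hv hpos
      (le_trans (by rw [pow_succ]; nlinarith) hcard)
    obtain ⟨𝒞₂, hsub₂, hne, hw₂⟩ := ih (h𝒞.subset hsub₁) hc₁
    refine ⟨𝒞₂, hsub₂.trans hsub₁, hne, ?_⟩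
    push_cast
    linarith

/-- The bound on the size of an antichain of small sets. -/
def antichainBound (k : ℕ) : ℕ := (4 ^ k + 1) ^ (2 * (k - 1))

lemma IsSmallAntichain.card_le {k : ℕ} {μ : ℝ} (hk : 2 ≤ k) (hμ : 0 < μ)
    (hP : G.KCutBound k (k * μ)) {X : Set V}
    (hX : ∀ D : Finset V, (∃ u ∈ X, u ∈ D) → (∃ u ∈ X, u ∉ D) →
      k * μ / (k - 1) ≤ G.mass (G.Sep D))
    {s v : V} (hs : s ∈ X) (hv : v ∈ X) {𝒞 : Finset (Finset V)}
    (h𝒞 : IsSmallAntichain G μ X s v 𝒞) : 𝒞.card ≤ antichainBound k := by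
  by_contra hcon
  obtain ⟨𝒞', hsub, ⟨B, hB⟩, hw⟩ := h𝒞.iterate hk hμ hP hX hs hv (2 * (k - 1)) (not_le.1 hcon).le
  have h1 := G.coreWeight_le hB
  have h2 := h𝒞.small B (hsub hB)
  have h3 : 0 ≤ G.coreWeight 𝒞 := G.mass_nonneg _
  have hk1 : (0 : ℝ) < k - 1 := by
    have : (2 : ℝ) ≤ k := by exact_mod_cast hk
    linarith
  -- Each round gains μ/(k-1), so 2(k-1) rounds reach 2μ, which no small set's boundary allows.
  have h4 : ((2 * (k - 1) : ℕ) : ℝ) * (k * μ / (k - 1) - μ) = 2 * μ := by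
    rw [Nat.cast_mul, Nat.cast_sub (by omega)]
    push_cast
    field_simp
    ring
  linarith

end WGraph

/-! ### Counting small sets. -/

namespace WGraph

variable {V ι : Type*} [Fintype ι] [Fintype V] {G : WGraph V ι}

/-- Sets whose traces on X have equal size m are pairwise incomparable, so each v ∈ X lies in
boundedly many of them. Double counting pairs (v, B) bounds layer m by nW/m, and summing over m
gives the logarithm. -/
lemma card_rooted_small_le {k : ℕ} {μ : ℝ} (hk : 2 ≤ k) (hμ : 0 < μ)
    (hP : G.KCutBound k (k * μ)) {X : Set V}
    (hX : ∀ D : Finset V, (∃ u ∈ X, u ∈ D) → (∃ u ∈ X, u ∉ D) →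
      k * μ / (k - 1) ≤ G.mass (G.Sep D))
    {s : V} (hs : s ∈ X) {𝒟 : Finset (Finset V)}
    (hsmall : ∀ B ∈ 𝒟, G.mass (G.Sep B) < 2 * μ) (hsB : ∀ B ∈ 𝒟, s ∉ B)
    (hagree : ∀ B ∈ 𝒟, ∀ D ∈ 𝒟, ∀ u ∉ X, (u ∈ B ↔ u ∈ D)) (hne : ∀ B ∈ 𝒟, ∃ u ∈ X, u ∈ B) :
    (𝒟.card : ℝ) ≤
      antichainBound k * (Fintype.card V * (1 + Real.log (Fintype.card V))) := by
  classical
  set n := Fintype.card V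
  set W := antichainBound k
  set A : Finset V → Finset V := fun B => {u ∈ B | u ∈ X} with hA
  have hmaps : ∀ B ∈ 𝒟, (A B).card ∈ Finset.Icc 1 n := by
    intro B hB
    obtain ⟨u, huX, huB⟩ := hne B hB
    exact Finset.mem_Icc.2 ⟨Finset.card_pos.2 ⟨u, by simp [hA, huX, huB]⟩, Finset.card_le_univ _⟩
  have hlayer : ∀ m, m * ({B ∈ 𝒟 | (A B).card = m}).card ≤ n * W := by
    intro m
    set 𝒟m := {B ∈ 𝒟 | (A B).card = m} with h𝒟m
    have hsub : 𝒟m ⊆ 𝒟 := Finset.filter_subset _ _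
    have h1 := Finset.sum_card_bipartiteAbove_eq_sum_card_bipartiteBelow
      (s := 𝒟m) (t := Finset.univ) (fun (B : Finset V) (v : V) => v ∈ A B)
    have h2 : ∑ B ∈ 𝒟m, (Finset.univ.bipartiteAbove (fun (B : Finset V) v => v ∈ A B) B).card =
        m * 𝒟m.card := by
      rw [Finset.sum_congr rfl (g := fun _ => m), Finset.sum_const, smul_eq_mul, mul_comm]
      intro B hB
      rw [Finset.bipartiteAbove, Finset.filter_univ_mem]
      exact (Finset.mem_filter.1 hB).2
    rw [← h2, h1]
    refine (Finset.sum_le_card_nsmul _ _ W fun v _ => ?_).trans_eq (by simp [n])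
    by_cases hv : v ∈ X
    swap
    · rw [Finset.bipartiteBelow, Finset.filter_false_of_mem (by simp [hA, hv])]
      simp
    refine IsSmallAntichain.card_le hk hμ hP hX hs hv ⟨?_, ?_, ?_, ?_, ?_⟩
    · exact fun B hB => hsmall B (hsub (Finset.mem_filter.1 hB).1)
    · exact fun B hB => hsB B (hsub (Finset.mem_filter.1 hB).1)
    · exact fun B hB => (Finset.mem_filter.1 (Finset.mem_filter.1 hB).2).1
    · exact fun B hB D hD => hagree B (hsub (Finset.mem_filter.1 hB).1) D
        (hsub (Finset.mem_filter.1 hD).1)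
    · intro B hB D hD hBD
      by_contra hcon
      push Not at hcon
      obtain ⟨hB𝒟, hBm⟩ := Finset.mem_filter.1 (Finset.mem_filter.1 hB).1
      obtain ⟨hD𝒟, hDm⟩ := Finset.mem_filter.1 (Finset.mem_filter.1 hD).1
      have hAA : A B = A D := Finset.eq_of_subset_of_card_le (fun u hu => by
        simp only [hA, Finset.mem_filter] at hu ⊢
        exact ⟨hcon u hu.1, hu.2⟩) (by rw [hBm, hDm])
      refine hBD (Finset.ext fun u => ?_)
      by_cases hu : u ∈ X
      · have := Finset.ext_iff.1 hAA u
        simpa [hA, hu] using this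
      · exact hagree B hB𝒟 D hD𝒟 u hu
  have hcard : (𝒟.card : ℝ) = ∑ m ∈ Finset.Icc 1 n, (({B ∈ 𝒟 | (A B).card = m}).card : ℝ) := by
    rw [Finset.card_eq_sum_card_fiberwise hmaps]
    push_cast
    rfl
  have hharm : ∑ m ∈ Finset.Icc 1 n, ((m : ℝ))⁻¹ ≤ 1 + Real.log n := by
    have := harmonic_le_one_add_log n
    rw [harmonic_eq_sum_Icc] at this
    push_cast at this
    exact this
  calc (𝒟.card : ℝ) ≤ ∑ m ∈ Finset.Icc 1 n, (n * W : ℝ) * (m : ℝ)⁻¹ := by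
        rw [hcard]
        refine Finset.sum_le_sum fun m hm => ?_
        have hm0 : (0 : ℝ) < m := by exact_mod_cast (Finset.mem_Icc.1 hm).1
        rw [← div_eq_mul_inv, le_div_iff₀ hm0, mul_comm]
        exact_mod_cast hlayer m
    _ = (n * W : ℝ) * ∑ m ∈ Finset.Icc 1 n, (m : ℝ)⁻¹ := by rw [Finset.mul_sum]
    _ ≤ (n * W : ℝ) * (1 + Real.log n) := by gcongr
    _ = W * (n * (1 + Real.log n)) := by ring

variable (G) in
open Classical in
/-- The sets of weight less than `2 * μ`. -/
noncomputable def smallSets (μ : ℝ) : Finset (Finset V) := {B | G.mass (G.Sep B) < 2 * μ}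

lemma mem_smallSets {μ : ℝ} {B : Finset V} : B ∈ G.smallSets μ ↔ G.mass (G.Sep B) < 2 * μ := by
  simp [smallSets]

lemma KCutBound.exists_stuck_heavy {k : ℕ} {μ : ℝ} (hk : 2 ≤ k)
    (hP : G.KCutBound k (k * μ)) :
    ∃ g : V → ℕ, (Finset.univ.image g).card < k ∧ G.Stuck (k * μ / (k - 1)) g := by
  have hk2 : (2 : ℝ) ≤ k := by exact_mod_cast hk
  have hcard : (Finset.univ.image fun _ : V => 0).card ≤ 1 :=
    Finset.card_le_one.2 fun a ha b hb => by simp_all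
  have hmass : G.mass (G.Cross fun _ : V => 0) = 0 := by simp [mass, Cross]
  rcases isEmpty_or_nonempty V with hV | hV
  · refine ⟨fun _ => 0, by omega, fun x D h => ?_⟩
    obtain ⟨u, -⟩ := h
    exact (hV.false u).elim
  have hcard : (Finset.univ.image fun _ : V => 0).card = 1 := by
    rw [Finset.image_const Finset.univ_nonempty]; simp
  -- The negative α reflects that the initial single class costs nothing: only k - 1 splits lead to
  -- k classes, and (k-1)·θ = kμ.
  obtain ⟨g, hg, -, hs⟩ := hP.exists_stuck (α := -(k * μ / (k - 1))) (θ := k * μ / (k - 1))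
    (by
      have : (k : ℝ) - 1 ≠ 0 := by linarith
      refine le_of_eq ?_
      field_simp
      ring) (fun _ => 0) (by omega) (by rw [hcard, hmass]; simp)
  exact ⟨g, hg, hs⟩

/-- The constant in the bound on the number of small sets. -/
def smallSetsConst (k : ℕ) : ℕ := 4 ^ k * (2 * antichainBound k + 1)

lemma card_smallSets_le [Nonempty V] {k : ℕ} {μ : ℝ} (hk : 2 ≤ k) (hμ : 0 < μ)
    (hP : G.KCutBound k (k * μ)) :
    ((G.smallSets μ).card : ℝ) ≤
      smallSetsConst k * (Fintype.card V * (1 + Real.log (Fintype.card V))) := by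
  classical
  have hk2 : (2 : ℝ) ≤ k := by exact_mod_cast hk
  have hθ : μ ≤ k * μ / (k - 1) := by
    rw [le_div_iff₀ (by linarith)]
    nlinarith
  obtain ⟨g, hgk, hstuck⟩ := hP.exists_stuck_heavy hk
  set N : ℝ := Fintype.card V * (1 + Real.log (Fintype.card V)) with hN
  have hn1 : (1 : ℝ) ≤ Fintype.card V := by exact_mod_cast Fintype.card_pos
  have hN1 : 1 ≤ N := by
    have := Real.log_nonneg hn1
    nlinarith
  have hfiber : ∀ σ : Finset ℕ × Finset ℕ,
      (({B ∈ G.smallSets μ | (B.image g, Bᶜ.image g) = σ}).card : ℝ) ≤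
        (2 * antichainBound k + 1) * N := by
    rintro ⟨S₁, S₂⟩
    set 𝒟 := {B ∈ G.smallSets μ | (B.image g, Bᶜ.image g) = (S₁, S₂)} with h𝒟
    have hmem : ∀ B ∈ 𝒟, G.mass (G.Sep B) < 2 * μ ∧ B.image g = S₁ ∧ Bᶜ.image g = S₂ := by
      intro B hB
      simpa only [h𝒟, Finset.mem_filter, mem_smallSets, Prod.mk.injEq] using hB
    have hagree : ∀ B ∈ 𝒟, ∀ D ∈ 𝒟, ∀ u, ¬ (g u ∈ S₁ ∧ g u ∈ S₂) → (u ∈ B ↔ u ∈ D) := by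
      intro B hB D hD u hu
      obtain ⟨-, h1, h2⟩ := hmem B hB
      obtain ⟨-, h3, h4⟩ := hmem D hD
      exact agree_of_image_eq (g := g) (h1.trans h3.symm) (h2.trans h4.symm) (by rwa [h1, h2])
    have hW : (0 : ℝ) ≤ antichainBound k := Nat.cast_nonneg _
    have hsplit : ∀ y ∈ S₁, y ∈ S₂ → ∀ B ∈ 𝒟,
        (∃ u, g u = y ∧ u ∈ B) ∧ ∃ u, g u = y ∧ u ∉ B := by
      intro y h1 h2 B hB
      obtain ⟨-, e1, e2⟩ := hmem B hB
      rw [← e1] at h1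
      rw [← e2] at h2
      obtain ⟨u, hu, rfl⟩ := Finset.mem_image.1 h1
      obtain ⟨u', hu', h'⟩ := Finset.mem_image.1 h2
      exact ⟨⟨u, rfl, hu⟩, ⟨u', h', Finset.mem_compl.1 hu'⟩⟩
    by_cases hS : ∃ x ∈ S₁, x ∈ S₂
    swap
    · have : 𝒟.card ≤ 1 := Finset.card_le_one.2 fun B hB D hD =>
        Finset.ext fun u => hagree B hB D hD u fun h => hS ⟨_, h⟩
      have : (𝒟.card : ℝ) ≤ 1 := by exact_mod_cast this
      nlinarith
    obtain ⟨x, hx₁, hx₂⟩ := hS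
    rcases 𝒟.eq_empty_or_nonempty with h0 | ⟨B₀, hB₀⟩
    · rw [h0]
      simp only [Finset.card_empty, Nat.cast_zero]
      positivity
    obtain ⟨⟨s, hsx, -⟩, -⟩ := hsplit x hx₁ hx₂ B₀ hB₀
    set X : Set V := {u | g u = x} with hXdef
    have hX : ∀ D : Finset V, (∃ u ∈ X, u ∈ D) → (∃ u ∈ X, u ∉ D) →
        k * μ / (k - 1) ≤ G.mass (G.Sep D) := fun D h1 h2 => hstuck.le_mass_sep h1 h2
    have hout : ∀ B ∈ 𝒟, ∀ D ∈ 𝒟, ∀ u ∉ X, (u ∈ B ↔ u ∈ D) := by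
      intro B hB D hD u hu
      refine hagree B hB D hD u fun h => hu ?_
      obtain ⟨a1, a2⟩ := hsplit _ h.1 h.2 B hB
      obtain ⟨b1, b2⟩ := hsplit x hx₁ hx₂ B hB
      exact hstuck.unique_split (lt_of_lt_of_le (hmem B hB).1 (by linarith)) a1 a2 b1 b2
    have h1 : (({B ∈ 𝒟 | s ∉ B}).card : ℝ) ≤ antichainBound k * N := by
      refine card_rooted_small_le hk hμ hP hX hsx ?_ ?_ ?_ ?_
      · exact fun B hB => (hmem B (Finset.mem_filter.1 hB).1).1
      · exact fun B hB => (Finset.mem_filter.1 hB).2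
      · exact fun B hB D hD => hout B (Finset.mem_filter.1 hB).1 D (Finset.mem_filter.1 hD).1
      · exact fun B hB => (hsplit x hx₁ hx₂ B (Finset.mem_filter.1 hB).1).1
    -- Sets containing the root s are counted through their complements, which have the same
    -- boundary.
    have h2 : ((({B ∈ 𝒟 | ¬ s ∉ B}).image compl).card : ℝ) ≤ antichainBound k * N := by
      have hget : ∀ B ∈ ({B ∈ 𝒟 | ¬ s ∉ B}).image compl, ∃ D ∈ 𝒟, s ∈ D ∧ B = Dᶜ := by
        intro B hB
        obtain ⟨D, hD, rfl⟩ := Finset.mem_image.1 hB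
        obtain ⟨hD, hs⟩ := Finset.mem_filter.1 hD
        exact ⟨D, hD, not_not.1 hs, rfl⟩
      refine card_rooted_small_le hk hμ hP hX hsx ?_ ?_ ?_ ?_
      · intro B hB
        obtain ⟨D, hD, -, rfl⟩ := hget B hB
        rw [mass_sep_compl]
        exact (hmem D hD).1
      · intro B hB
        obtain ⟨D, hD, hs, rfl⟩ := hget B hB
        simpa using hs
      · intro B hB B' hB' u hu
        obtain ⟨D, hD, -, rfl⟩ := hget B hB
        obtain ⟨D', hD', -, rfl⟩ := hget B' hB'
        simp only [Finset.mem_compl, hout D hD D' hD' u hu]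
      · intro B hB
        obtain ⟨D, hD, -, rfl⟩ := hget B hB
        obtain ⟨u, hu, hu'⟩ := (hsplit x hx₁ hx₂ D hD).2
        exact ⟨u, hu, Finset.mem_compl.2 hu'⟩
    rw [Finset.card_image_of_injective _ compl_injective] at h2
    rw [← Finset.card_filter_add_card_filter_not (s := 𝒟) (fun B => s ∉ B)]
    push_cast
    nlinarith
  have hmaps : ∀ B ∈ G.smallSets μ, (B.image g, Bᶜ.image g) ∈
      (Finset.univ.image g).powerset ×ˢ (Finset.univ.image g).powerset :=
    fun B _ => signature_mem g B
  rw [Finset.card_eq_sum_card_fiberwise hmaps]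
  push_cast
  refine (Finset.sum_le_card_nsmul _ _ _ fun σ _ => hfiber σ).trans ?_
  rw [nsmul_eq_mul, smallSetsConst]
  push_cast
  rw [mul_assoc]
  gcongr
  exact_mod_cast card_signatures_le hgk

end WGraph

/-! ### Contraction and classes of low degree. -/

namespace WGraph

variable {V ι : Type*} [Fintype ι] [Fintype V] (G : WGraph V ι)

open Classical in
/-- The labelling obtained from `f` by contracting the edge `e`. -/
noncomputable def contract (f : V → V) (e : ι) (v : V) : V :=
  if f v = f (G.snd e) then f (G.fst e) else f v

variable {G}

omit [Fintype ι] [Fintype V] in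
lemma contract_eq_contract_iff {f : V → V} {e : ι} {u v : V} :
    G.contract f e u = G.contract f e v ↔ f u = f v ∨
      (f u = f (G.fst e) ∨ f u = f (G.snd e)) ∧ (f v = f (G.fst e) ∨ f v = f (G.snd e)) := by
  unfold contract
  split_ifs <;> grind

omit [Fintype ι] in
lemma card_image_contract [DecidableEq V] {f : V → V} {e : ι} (he : G.Cross f e) :
    (Finset.univ.image (G.contract f e)).card + 1 = (Finset.univ.image f).card := by
  have : Finset.univ.image (G.contract f e) = (Finset.univ.image f).erase (f (G.snd e)) := by
    ext y
    simp only [Finset.mem_image, Finset.mem_univ, true_and, Finset.mem_erase, contract]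
    constructor
    · rintro ⟨v, rfl⟩
      split_ifs with h
      · exact ⟨he, _, rfl⟩
      · exact ⟨h, _, rfl⟩
    · rintro ⟨h, v, rfl⟩
      exact ⟨v, if_neg h⟩
  rw [this, Finset.card_erase_add_one (by simp)]

/-- `B` is a union of classes of `f`. -/
def Compat (f : V → V) (B : Finset V) : Prop := ∀ u v, f u = f v → (u ∈ B ↔ v ∈ B)

omit [Fintype ι] [Fintype V] in
lemma compat_contract_iff {f : V → V} {e : ι} {B : Finset V} :
    Compat (G.contract f e) B ↔ Compat f B ∧ ¬ G.Sep B e := by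
  unfold Compat Sep
  simp only [contract_eq_contract_iff, not_not]
  constructor
  · exact fun h => ⟨fun u v huv => h u v (Or.inl huv), h _ _ (Or.inr ⟨Or.inl rfl, Or.inr rfl⟩)⟩
  · rintro ⟨h, hs⟩ u v (huv | ⟨hu, hv⟩)
    · exact h u v huv
    · have h1 := h u (G.fst e)
      have h2 := h u (G.snd e)
      have h3 := h v (G.fst e)
      have h4 := h v (G.snd e)
      tauto

/-- The edges of `F` are exactly those joining different parts of a partition coarser than the
one given by `f`. -/
def Survives (G : WGraph V ι) (f : V → V) (F : Finset ι) : Prop :=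
  ∃ g : V → ℕ, (∀ e, e ∈ F ↔ G.Cross g e) ∧ ∀ u v, f u = f v → g u = g v

omit [Fintype ι] [Fintype V] in
lemma Survives.contract {f : V → V} {F : Finset ι} (h : G.Survives f F) {e : ι} (he : e ∉ F) :
    G.Survives (G.contract f e) F := by
  obtain ⟨g, hg, hgf⟩ := h
  refine ⟨g, hg, fun u v huv => ?_⟩
  have hge : g (G.fst e) = g (G.snd e) := not_not.1 fun h => he ((hg e).2 h)
  rcases contract_eq_contract_iff.1 huv with h | ⟨hu, hv⟩
  · exact hgf u v h
  · have hu' : g u = g (G.snd e) := hu.elim (fun h => (hgf _ _ h).trans hge) (hgf _ _)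
    have hv' : g v = g (G.snd e) := hv.elim (fun h => (hgf _ _ h).trans hge) (hgf _ _)
    rw [hu', hv']

omit [Fintype ι] in
-- A surviving F is determined by the set of pairs of classes of `f` that it separates.
lemma card_survives_le [DecidableEq V] {f : V → V} {𝓕 : Finset (Finset ι)}
    (h : ∀ F ∈ 𝓕, G.Survives f F) : 𝓕.card ≤ 2 ^ ((Finset.univ.image f).card ^ 2) := by
  classical
  choose! g hg hgf using h
  have key : ∀ F ∈ 𝓕, ∀ e, e ∈ F ↔ ∃ u v, f u = f (G.fst e) ∧ f v = f (G.snd e) ∧ g F u ≠ g F v := by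
    intro F hF e
    rw [hg F hF e]
    constructor
    · exact fun h => ⟨_, _, rfl, rfl, h⟩
    · rintro ⟨u, v, hu, hv, huv⟩
      rwa [hgf F hF _ _ hu, hgf F hF _ _ hv] at huv
  set S : Finset ι → Finset (V × V) := fun F =>
    {p ∈ Finset.univ.image f ×ˢ Finset.univ.image f | ∃ u v, f u = p.1 ∧ f v = p.2 ∧ g F u ≠ g F v}
    with hS
  have hcard : ((Finset.univ.image f ×ˢ Finset.univ.image f).powerset).card =
      2 ^ ((Finset.univ.image f).card ^ 2) := by
    rw [Finset.card_powerset, Finset.card_product, sq]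
  rw [← hcard]
  refine Finset.card_le_card_of_injOn S (fun F _ => ?_) fun F hF F' hF' hFF' => ?_
  · exact Finset.mem_coe.2 (Finset.mem_powerset.2 (Finset.filter_subset _ _))
  · ext e
    rw [key F hF e, key F' hF' e]
    have := Finset.ext_iff.1 hFF' (f (G.fst e), f (G.snd e))
    simpa [hS] using this

open Classical in
/-- The class of `f` with label `x`. -/
noncomputable def fiber (f : V → V) (x : V) : Finset V := {v | f v = x}

omit [Fintype ι] in
lemma sep_fiber_iff {f : V → V} {x : V} {e : ι} :
    G.Sep (fiber f x) e ↔ ¬ (f (G.fst e) = x ↔ f (G.snd e) = x) := by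
  simp [Sep, fiber]

/-- A crossing edge lies on the boundary of only the two classes containing its ends. -/
lemma sum_mass_fiber_le (f : V → V) (S : Finset V) (p : ι → Prop) :
    ∑ x ∈ S, G.mass (fun e => G.Sep (fiber f x) e ∧ p e) ≤
      2 * G.mass (fun e => G.Cross f e ∧ p e) := by
  classical
  unfold mass
  rw [Finset.sum_comm, Finset.mul_sum]
  refine Finset.sum_le_sum fun e _ => ?_
  have hw := G.w_pos e
  beta_reduce
  by_cases hp : G.Cross f e ∧ p e
  · have hcount : ∑ x ∈ S, (if G.Sep (fiber f x) e ∧ p e then G.w e else 0) =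
        ({x ∈ S | G.Sep (fiber f x) e ∧ p e}).card * G.w e := by
      rw [← nsmul_eq_mul, ← Finset.sum_const, Finset.sum_filter]
    rw [if_pos hp]
    refine le_trans (le_of_eq (Eq.trans ?_ hcount)) ?_
    · exact Finset.sum_congr rfl fun x _ => by congr
    gcongr
    have : {x ∈ S | G.Sep (fiber f x) e ∧ p e} ⊆ {f (G.fst e), f (G.snd e)} := by
      intro x hx
      have := sep_fiber_iff.1 (Finset.mem_filter.1 hx).2.1
      simp only [Finset.mem_insert, Finset.mem_singleton]
      by_contra hcon
      push Not at hcon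
      exact this ⟨fun h => absurd h.symm hcon.1, fun h => absurd h.symm hcon.2⟩
    exact_mod_cast (Finset.card_le_card this).trans Finset.card_le_two
  · rw [if_neg hp, mul_zero]
    refine (Finset.sum_eq_zero fun x _ => if_neg fun h => hp ⟨fun hf => ?_, h.2⟩).le
    exact sep_fiber_iff.1 h.1 (by rw [hf])

/-- Isolating `k - 1` classes is a `k`-cut. -/
lemma KCutBound.le_sum_fiber [DecidableEq V] {k : ℕ} {lam : ℝ} (hP : G.KCutBound k lam)
    {f : V → V} {S : Finset V} (hS : S ⊆ Finset.univ.image f) (hcard : S.card + 1 = k)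
    (hk : k ≤ (Finset.univ.image f).card) :
    lam ≤ ∑ x ∈ S, G.mass (G.Sep (fiber f x)) := by
  classical
  obtain ⟨z, hz, hzS⟩ : ∃ z ∈ Finset.univ.image f, z ∉ S := by
    by_contra hcon
    push Not at hcon
    have := Finset.card_le_card hcon
    omega
  obtain ⟨z, -, rfl⟩ := Finset.mem_image.1 hz
  -- Label 0 collects all classes outside S; the class of z shows that it occurs, giving k labels in
  -- total.
  set g : V → ℕ := fun v => if f v ∈ S then (Fintype.equivFin V (f v) : ℕ) + 1 else 0 with hg
  have himg : insert 0 (S.image fun x => (Fintype.equivFin V x : ℕ) + 1) ⊆ Finset.univ.image g := by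
    intro y hy
    rcases Finset.mem_insert.1 hy with rfl | hy
    · exact Finset.mem_image.2 ⟨z, Finset.mem_univ _, if_neg hzS⟩
    · obtain ⟨x, hx, rfl⟩ := Finset.mem_image.1 hy
      obtain ⟨v, -, rfl⟩ := Finset.mem_image.1 (hS hx)
      exact Finset.mem_image.2 ⟨v, Finset.mem_univ _, if_pos hx⟩
  have hkg : k ≤ (Finset.univ.image g).card := by
    refine le_trans (le_of_eq ?_) (Finset.card_le_card himg)
    rw [Finset.card_insert_of_notMem (by simp), Finset.card_image_of_injective, hcard]
    intro x y hxy
    simpa [Fin.val_inj] using hxy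
  refine (hP g hkg).trans ?_
  unfold mass
  rw [Finset.sum_comm]
  refine Finset.sum_le_sum fun e _ => ?_
  have hw := G.w_pos e
  have hnn : ∀ x ∈ S, (0 : ℝ) ≤ if G.Sep (fiber f x) e then G.w e else 0 := fun x _ => by
    split_ifs <;> linarith
  split_ifs with he
  · by_cases ha : f (G.fst e) ∈ S
    · refine le_trans (le_of_eq (if_pos ?_).symm) (Finset.single_le_sum hnn ha)
      rw [sep_fiber_iff]
      exact fun h => he (by simp only [hg, h.1 rfl])
    · by_cases hb : f (G.snd e) ∈ S
      · refine le_trans (le_of_eq (if_pos ?_).symm) (Finset.single_le_sum hnn hb)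
        rw [sep_fiber_iff]
        exact fun h => he (by simp only [hg, h.2 rfl])
      · exact absurd (by simp only [hg, if_neg ha, if_neg hb]) he
  · exact Finset.sum_nonneg hnn

/-- Few classes are joined to the rest by little weight outside a fixed set of edges of
weight at most `k * μ`. -/
lemma KCutBound.card_light_le [DecidableEq V] {k : ℕ} {μ : ℝ} (hk : 2 ≤ k) (hμ : 0 < μ)
    (hP : G.KCutBound k (k * μ)) {f : V → V} (hf : k ≤ (Finset.univ.image f).card)
    {F : Finset ι} (hF : G.mass (· ∈ F) ≤ k * μ) {S : Finset V} (hS : S ⊆ Finset.univ.image f)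
    (hlight : ∀ x ∈ S, G.mass (fun e => G.Sep (fiber f x) e ∧ e ∉ F) < μ * (1 + 1 / k)) :
    S.card ≤ 2 * k ^ 3 := by
  classical
  have hk2 : (2 : ℝ) ≤ k := by exact_mod_cast hk
  have hk1 : (0 : ℝ) < k - 1 := by linarith
  -- Chosen so that μ(1 + 1/k) + ε = kμ/(k-1), the average boundary available to k - 1 isolated
  -- classes.
  set ε : ℝ := μ / (k * (k - 1)) with hε
  have hε0 : 0 < ε := by positivity
  set H := {x ∈ S | ε ≤ G.mass (fun e => G.Sep (fiber f x) e ∧ e ∈ F)} with hH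
  set L := {x ∈ S | ¬ ε ≤ G.mass (fun e => G.Sep (fiber f x) e ∧ e ∈ F)} with hL
  have hHL : H.card + L.card = S.card := Finset.card_filter_add_card_filter_not _
  have hHcard : (H.card : ℝ) ≤ 2 * k ^ 2 * (k - 1) := by
    have h1 : H.card • ε ≤ ∑ x ∈ H, G.mass (fun e => G.Sep (fiber f x) e ∧ e ∈ F) :=
      Finset.card_nsmul_le_sum _ _ _ fun x hx => (Finset.mem_filter.1 hx).2
    have h2 := sum_mass_fiber_le (G := G) f H (· ∈ F)
    have h3 : G.mass (fun e => G.Cross f e ∧ e ∈ F) ≤ G.mass (· ∈ F) :=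
      G.mass_mono fun _ h => h.2
    rw [nsmul_eq_mul] at h1
    have h4 : H.card * ε ≤ 2 * (k * μ) := by linarith
    rw [hε, mul_div_assoc', div_le_iff₀ (by positivity)] at h4
    have h5 : μ * H.card ≤ μ * (2 * k ^ 2 * (k - 1)) := by linarith
    exact le_of_mul_le_mul_left h5 hμ
  -- Isolating k - 1 classes of L would be a k-cut of weight below kμ.
  have hLcard : L.card < k - 1 := by
    by_contra hcon
    obtain ⟨S', hS'L, hS'card⟩ := Finset.exists_subset_card_eq (not_lt.1 hcon)
    have hS'S : S' ⊆ S := hS'L.trans (Finset.filter_subset _ _)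
    have hle := hP.le_sum_fiber (hS'S.trans hS) (by omega) hf
    have hlt : ∑ x ∈ S', G.mass (G.Sep (fiber f x)) < ∑ x ∈ S', (μ * k / (k - 1)) := by
      refine Finset.sum_lt_sum_of_nonempty (Finset.card_pos.1 (by omega)) fun x hx => ?_
      have h1 := hlight x (hS'S hx)
      have h2 := not_le.1 (Finset.mem_filter.1 (hS'L hx)).2
      have h3 : G.mass (G.Sep (fiber f x)) ≤ G.mass (fun e => G.Sep (fiber f x) e ∧ e ∉ F) +
          G.mass (fun e => G.Sep (fiber f x) e ∧ e ∈ F) := G.mass_le_add fun e _ => by tauto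
      have h4 : μ * (1 + 1 / k) + ε = μ * k / (k - 1) := by
        rw [hε]
        field_simp
        ring
      linarith
    rw [Finset.sum_const, hS'card, nsmul_eq_mul, Nat.cast_sub (by omega), Nat.cast_one,
      mul_div_cancel₀ _ hk1.ne'] at hlt
    linarith
  have hfin : (S.card : ℝ) ≤ 2 * k ^ 3 := by
    have h1 : (L.card : ℝ) ≤ k := by exact_mod_cast (by omega : L.card ≤ k)
    have h2 : (S.card : ℝ) = H.card + L.card := by exact_mod_cast hHL.symm
    nlinarith [mul_self_nonneg ((k : ℝ) - 1)]
  exact_mod_cast hfin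

end WGraph

/-! ### The potential and the contraction argument. -/

namespace WGraph

variable {V ι : Type*} [Fintype ι] [Fintype V] (G : WGraph V ι)

open Classical in
/-- The small sets compatible with `f` whose boundary is not mostly contained in `F`. -/
noncomputable def heavySmallSets (k : ℕ) (μ : ℝ) (F : Finset ι) (f : V → V) :
    Finset (Finset V) :=
  {B ∈ G.smallSets μ | μ * (1 + 1 / k) ≤ G.mass (fun e => G.Sep B e ∧ e ∉ F) ∧ Compat f B}

open Classical in
/-- The potential driving the analysis of random contraction: the number of classes, minus a
constant, plus `k` times the number of remaining small sets. -/
noncomputable def potential (k : ℕ) (μ : ℝ) (F : Finset ι) (f : V → V) : ℝ :=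
  (Finset.univ.image f).card - (2 * k ^ 3 + k) + k * (G.heavySmallSets k μ F f).card

variable {G}

lemma mem_heavySmallSets {k : ℕ} {μ : ℝ} {F : Finset ι} {f : V → V} {B : Finset V} :
    B ∈ G.heavySmallSets k μ F f ↔ G.mass (G.Sep B) < 2 * μ ∧
      μ * (1 + 1 / k) ≤ G.mass (fun e => G.Sep B e ∧ e ∉ F) ∧ Compat f B := by
  simp [heavySmallSets, mem_smallSets]

open Classical in
-- Contracting e loses one class and destroys exactly those small sets whose boundary contains e.
lemma potential_sub_contract {k : ℕ} {μ : ℝ} {F : Finset ι} {f : V → V} {e : ι}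
    (he : G.Cross f e) :
    G.potential k μ F f - G.potential k μ F (G.contract f e) =
      1 + k * ({B ∈ G.heavySmallSets k μ F f | G.Sep B e}).card := by
  have h1 := card_image_contract he
  have h2 : G.heavySmallSets k μ F (G.contract f e) =
      {B ∈ G.heavySmallSets k μ F f | ¬ G.Sep B e} := by
    ext B
    simp only [Finset.mem_filter, mem_heavySmallSets, compat_contract_iff]
    tauto
  have h3 := Finset.card_filter_add_card_filter_not
    (s := G.heavySmallSets k μ F f) (fun B => G.Sep B e)
  rw [← h2] at h3
  unfold potential
  rw [← h1, ← h3]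
  push_cast
  ring

lemma le_potential (k : ℕ) (μ : ℝ) (F : Finset ι) (f : V → V) [DecidableEq V] :
    ((Finset.univ.image f).card : ℝ) - (2 * k ^ 3 + k) ≤ G.potential k μ F f := by
  classical
  have : (0 : ℝ) ≤ k * (G.heavySmallSets k μ F f).card := by positivity
  unfold potential
  convert le_add_of_nonneg_right this

open Classical in
/-- After a random contraction avoiding `F` the potential decreases at rate at least `μ`. -/
lemma KCutBound.potential_drift [DecidableEq V] {k : ℕ} {μ : ℝ} (hk : 2 ≤ k) (hμ : 0 < μ)
    (hP : G.KCutBound k (k * μ)) {F : Finset ι} (hF : G.mass (· ∈ F) ≤ k * μ) {f : V → V}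
    (hf : k ≤ (Finset.univ.image f).card) :
    μ * G.potential k μ F f ≤ ∑ e with G.Cross f e ∧ e ∉ F,
      G.w e * (G.potential k μ F f - G.potential k μ F (G.contract f e)) := by
  classical
  have hk0 : (0 : ℝ) < k := by exact_mod_cast (by omega : 0 < k)
  set T := G.heavySmallSets k μ F f with hT
  have hsum : ∑ e with G.Cross f e ∧ e ∉ F,
      G.w e * (G.potential k μ F f - G.potential k μ F (G.contract f e)) =
      G.mass (fun e => G.Cross f e ∧ e ∉ F) +
        k * ∑ B ∈ T, G.mass (fun e => G.Sep B e ∧ e ∉ F) := by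
    have h1 : ∀ e ∈ ({e | G.Cross f e ∧ e ∉ F} : Finset ι),
        G.w e * (G.potential k μ F f - G.potential k μ F (G.contract f e)) =
        G.w e + k * ∑ B ∈ T, if G.Sep B e then G.w e else 0 := by
      intro e he
      rw [potential_sub_contract (Finset.mem_filter.1 he).2.1, ← Finset.sum_filter,
        Finset.sum_const, nsmul_eq_mul]
      ring
    rw [Finset.sum_congr rfl h1, Finset.sum_add_distrib, ← Finset.mul_sum, Finset.sum_comm]
    congr 1
    · rw [mass, Finset.sum_filter]
      exact Finset.sum_congr rfl fun e _ => by congr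
    · congr 1
      refine Finset.sum_congr rfl fun B hB => ?_
      rw [mass, Finset.sum_filter]
      refine Finset.sum_congr rfl fun e _ => ?_
      have : G.Sep B e → G.Cross f e := fun h hf => h ((mem_heavySmallSets.1 hB).2.2 _ _ hf)
      by_cases a : G.Sep B e <;> by_cases b : e ∈ F <;> simp_all
  have hT' : T.card • (μ * (1 + 1 / k)) ≤ ∑ B ∈ T, G.mass (fun e => G.Sep B e ∧ e ∉ F) :=
    Finset.card_nsmul_le_sum _ _ _ fun B hB => (mem_heavySmallSets.1 hB).2.1
  rw [nsmul_eq_mul] at hT'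
  have hcross : G.mass (G.Cross f) ≤
      G.mass (fun e => G.Cross f e ∧ e ∉ F) + G.mass (· ∈ F) :=
    G.mass_le_add fun e _ => by tauto
  set I := Finset.univ.image f with hI
  set L := {x ∈ I | G.mass (fun e => G.Sep (fiber f x) e ∧ e ∉ F) < μ * (1 + 1 / k)} with hL
  have hLcard : L.card ≤ 2 * k ^ 3 := hP.card_light_le hk hμ hf hF (Finset.filter_subset _ _)
    fun x hx => (Finset.mem_filter.1 hx).2
  -- Non-light classes of degree below 2μ are themselves heavy small sets, so T pays for them; the
  -- classes left in N have degree at least 2μ.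
  set M := {x ∈ I | x ∉ L ∧ G.mass (G.Sep (fiber f x)) < 2 * μ} with hM
  have hMcard : M.card ≤ T.card := by
    refine Finset.card_le_card_of_injOn (fiber f) (fun x hx => ?_) fun x hx y hy hxy => ?_
    · obtain ⟨hxI, hxL, hx2⟩ := Finset.mem_filter.1 hx
      refine mem_heavySmallSets.2 ⟨hx2, ?_, fun u v huv => by simp [fiber, huv]⟩
      by_contra hcon
      exact hxL (Finset.mem_filter.2 ⟨hxI, not_le.1 hcon⟩)
    · obtain ⟨v, -, rfl⟩ := Finset.mem_image.1 (Finset.mem_filter.1 hx).1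
      have : v ∈ fiber f y := hxy ▸ (by simp [fiber])
      simpa [fiber] using this
  set N := {x ∈ I | ¬ (x ∈ L ∨ x ∈ M)} with hN
  have hNcard : I.card ≤ L.card + M.card + N.card := by
    have : I ⊆ L ∪ M ∪ N := by
      intro x hx
      simp only [Finset.mem_union, hN, Finset.mem_filter]
      tauto
    refine (Finset.card_le_card this).trans ((Finset.card_union_le _ _).trans ?_)
    gcongr
    exact Finset.card_union_le _ _
  have hdeg : N.card • (2 * μ) ≤ ∑ x ∈ N, G.mass (fun e => G.Sep (fiber f x) e ∧ True) := by
    refine Finset.card_nsmul_le_sum _ _ _ fun x hx => ?_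
    obtain ⟨hxI, hx'⟩ := Finset.mem_filter.1 hx
    push Not at hx'
    by_contra hcon
    refine hx'.2 (Finset.mem_filter.2 ⟨hxI, hx'.1, ?_⟩)
    simpa using hcon
  rw [nsmul_eq_mul] at hdeg
  have htotal := sum_mass_fiber_le (G := G) f N fun _ => True
  have hctrue : G.mass (fun e => G.Cross f e ∧ True) = G.mass (G.Cross f) :=
    G.mass_congr fun _ => by simp
  have hNreal : (I.card : ℝ) ≤ 2 * k ^ 3 + T.card + N.card := by
    exact_mod_cast (by omega : I.card ≤ 2 * k ^ 3 + T.card + N.card)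
  have hpot : G.potential k μ F f = I.card - (2 * k ^ 3 + k) + k * T.card := by
    unfold potential
    congr!
  rw [hsum, hpot]
  have h5 : k * (T.card * (μ * (1 + 1 / k))) = (T.card : ℝ) * μ * (k + 1) := by
    field_simp
  have h6 := mul_le_mul_of_nonneg_left hT' hk0.le
  have h7 := mul_le_mul_of_nonneg_left hNreal hμ.le
  rw [h5] at h6
  rw [hctrue] at htotal
  -- The crossing weight is at least μ(|I| - 2k³ - |T|), F removes at most kμ of it, and the sets in
  -- T contribute at least (k+1)μ|T|. The total is exactly μΦ.
  nlinarith

lemma inv_pow_bernoulli {x y : ℝ} (hx : 0 < x) (hy : 0 < y) (k : ℕ) :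
    (x⁻¹) ^ k * (1 + k * ((x - y) / x)) ≤ (y⁻¹) ^ k := by
  have h1 : (x - y) / x ≤ x / y - 1 := by
    rw [div_sub_one hy.ne', div_le_div_iff₀ hx hy]
    nlinarith [sq_nonneg (x - y)]
  have h2 := one_add_mul_le_pow (a := x / y - 1) (by have := div_pos hx hy; linarith) k
  have h3 : (1 : ℝ) + k * ((x - y) / x) ≤ (x / y) ^ k := by
    refine le_trans ?_ (h2.trans_eq (by ring))
    gcongr
  calc _ ≤ (x⁻¹) ^ k * (x / y) ^ k := by gcongr
    _ = (y⁻¹) ^ k := by rw [← mul_pow]; congr 1; field_simp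

/-- The number of classes at which contraction stops. -/
def stopSize (k : ℕ) : ℕ := 2 * k ^ 3 + k + 1

/-- Φ^(-k) plays the role of a lower bound, up to a constant, for the probability that F survives
contraction down to `stopSize k` classes. There Φ ≥ 1 and few F can survive. -/
lemma KCutBound.sum_potential_le [DecidableEq V] {k : ℕ} {μ : ℝ} (hk : 2 ≤ k) (hμ : 0 < μ)
    (hP : G.KCutBound k (k * μ)) {f : V → V} (hf : stopSize k ≤ (Finset.univ.image f).card)
    {𝓕 : Finset (Finset ι)} (h𝓕 : ∀ F ∈ 𝓕, G.mass (· ∈ F) ≤ k * μ ∧ G.Survives f F) :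
    ∑ F ∈ 𝓕, ((G.potential k μ F f)⁻¹) ^ k ≤ 2 ^ (stopSize k ^ 2) := by
  classical
  obtain ⟨d, hd⟩ : ∃ d, (Finset.univ.image f).card = stopSize k + d :=
    ⟨_, (Nat.add_sub_of_le hf).symm⟩
  have hone : ∀ f' : V → V, stopSize k ≤ (Finset.univ.image f').card → ∀ F,
      1 ≤ G.potential k μ F f' := by
    intro f' hf' F
    refine le_trans ?_ (le_potential k μ F f')
    have : ((stopSize k : ℕ) : ℝ) ≤ (Finset.univ.image f').card := by exact_mod_cast hf'
    unfold stopSize at this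
    push_cast at this
    linarith
  induction d generalizing f 𝓕 with
  | zero =>
    have h1 : ∀ F ∈ 𝓕, ((G.potential k μ F f)⁻¹) ^ k ≤ 1 := fun F _ =>
      pow_le_one₀ (inv_nonneg.2 (zero_le_one.trans (hone f hf F)))
        (inv_le_one_of_one_le₀ (hone f hf F))
    refine (Finset.sum_le_card_nsmul _ _ _ h1).trans ?_
    rw [nsmul_eq_mul, mul_one]
    have := card_survives_le fun F hF => (h𝓕 F hF).2
    rw [hd, add_zero] at this
    exact_mod_cast this
  | succ d ih =>
    have hkf : k ≤ (Finset.univ.image f).card := by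
      refine le_trans ?_ hf
      unfold stopSize
      omega
    set m := G.mass (G.Cross f) with hm
    have hm0 : 0 < m := by
      have hcard : (Finset.univ.image fun v => (Fintype.equivFin V (f v) : ℕ)).card =
          (Finset.univ.image f).card := by
        rw [← Finset.card_image_of_injective (Finset.univ.image f)
          (f := fun v => (Fintype.equivFin V v : ℕ)) (fun u v huv => by
            simpa [Fin.val_inj] using huv), Finset.image_image]
        rfl
      have h1 := hP (fun v => (Fintype.equivFin V (f v) : ℕ)) (hcard ▸ hkf)
      have h2 : 0 < (k : ℝ) * μ := by
        have : (0 : ℝ) < k := by exact_mod_cast (by omega : 0 < k)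
        positivity
      refine lt_of_lt_of_le h2 (h1.trans (G.mass_mono fun e he hfe => he ?_))
      simp only [hfe]
    have hstep : ∀ F ∈ 𝓕, m * ((G.potential k μ F f)⁻¹) ^ k ≤
        ∑ e with G.Cross f e ∧ e ∉ F,
          G.w e * ((G.potential k μ F (G.contract f e))⁻¹) ^ k := by
      intro F hF
      have hFm := (h𝓕 F hF).1
      have hX := hone f hf F
      set X := G.potential k μ F f with hXdef
      have hX0 : 0 < X := by linarith
      have hdrift := hP.potential_drift hk hμ hFm hkf
      rw [← hXdef] at hdrift
      -- Bernoulli linearises Φ^(-k); the drift then supplies a gain of kμ, which covers the weight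
      -- of F excluded from the contraction.
      have hb : ∑ e with G.Cross f e ∧ e ∉ F,
          G.w e * ((X⁻¹) ^ k * (1 + k * ((X - G.potential k μ F (G.contract f e)) / X))) ≤
          ∑ e with G.Cross f e ∧ e ∉ F,
            G.w e * ((G.potential k μ F (G.contract f e))⁻¹) ^ k := by
        refine Finset.sum_le_sum fun e he => ?_
        have hc := card_image_contract (Finset.mem_filter.1 he).2.1
        have := hone (G.contract f e) (by omega) F
        have hw := (G.w_pos e).le
        gcongr
        exact inv_pow_bernoulli hX0 (by linarith) k
      refine le_trans ?_ hb
      have hrw : ∑ e with G.Cross f e ∧ e ∉ F,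
          G.w e * ((X⁻¹) ^ k * (1 + k * ((X - G.potential k μ F (G.contract f e)) / X))) =
          (X⁻¹) ^ k * (G.mass (fun e => G.Cross f e ∧ e ∉ F) + k / X *
            ∑ e with G.Cross f e ∧ e ∉ F,
              G.w e * (X - G.potential k μ F (G.contract f e))) := by
        have : G.mass (fun e => G.Cross f e ∧ e ∉ F) = ∑ e with G.Cross f e ∧ e ∉ F, G.w e := by
          rw [mass, Finset.sum_filter]
          exact Finset.sum_congr rfl fun e _ => by congr
        rw [this, Finset.mul_sum, ← Finset.sum_add_distrib, Finset.mul_sum]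
        refine Finset.sum_congr rfl fun e _ => ?_
        ring
      rw [hrw, mul_comm]
      gcongr
      have h1 : m ≤ G.mass (fun e => G.Cross f e ∧ e ∉ F) + G.mass (· ∈ F) :=
        G.mass_le_add fun e _ => by tauto
      have h2 : (k : ℝ) * μ = k / X * (μ * X) := by field_simp
      have h3 : k / X * (μ * X) ≤ k / X * ∑ e with G.Cross f e ∧ e ∉ F,
              G.w e * (X - G.potential k μ F (G.contract f e)) := by
        gcongr
      linarith
    -- Exchange the sums over F and e; for each e, induction applies to the cuts that avoid e.
    have hexch : m * ∑ F ∈ 𝓕, ((G.potential k μ F f)⁻¹) ^ k ≤ m * 2 ^ (stopSize k ^ 2) := by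
      rw [Finset.mul_sum]
      refine (Finset.sum_le_sum hstep).trans ?_
      simp only [Finset.sum_filter]
      rw [Finset.sum_comm, hm, mass, Finset.sum_mul]
      refine Finset.sum_le_sum fun e _ => ?_
      by_cases he : G.Cross f e
      · have hc := card_image_contract he
        have := ih (f := G.contract f e) (𝓕 := {F ∈ 𝓕 | e ∉ F}) (by omega)
          (fun F hF => ⟨(h𝓕 F (Finset.mem_filter.1 hF).1).1,
            (h𝓕 F (Finset.mem_filter.1 hF).1).2.contract (Finset.mem_filter.1 hF).2⟩) (by omega)
        rw [if_pos he]
        refine le_trans (le_of_eq ?_) (mul_le_mul_of_nonneg_left this (G.w_pos e).le)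
        rw [Finset.sum_filter, Finset.mul_sum]
        refine Finset.sum_congr rfl fun F _ => ?_
        by_cases h : e ∈ F <;> simp [he, h]
      · simp [he]
    exact le_of_mul_le_mul_left hexch hm0

/-- A bound on the number of minimum `k`-cuts in terms of the number of small sets. -/
lemma KCutBound.card_le_of_smallSets {k : ℕ} {μ : ℝ} (hk : 2 ≤ k) (hμ : 0 < μ)
    (hP : G.KCutBound k (k * μ)) {𝓕 : Finset (Finset ι)}
    (h𝓕 : ∀ F ∈ 𝓕, G.mass (· ∈ F) ≤ k * μ ∧ G.Survives id F) [Nonempty V] :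
    (𝓕.card : ℝ) ≤
      2 ^ (stopSize k ^ 2) * (Fintype.card V + k * (G.smallSets μ).card : ℝ) ^ k := by
  classical
  have himg : (Finset.univ.image (id : V → V)).card = Fintype.card V := by simp
  set Y : ℝ := Fintype.card V + k * (G.smallSets μ).card with hY
  have hY1 : 1 ≤ Y := by
    have h1 : (1 : ℝ) ≤ Fintype.card V := by exact_mod_cast Fintype.card_pos
    have h2 : (0 : ℝ) ≤ k * (G.smallSets μ).card := by positivity
    linarith
  rcases le_or_gt (stopSize k) (Fintype.card V) with hn | hn
  · have h1 := hP.sum_potential_le hk hμ (by rwa [himg]) h𝓕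
    have h2 : ∀ F ∈ 𝓕, (Y⁻¹) ^ k ≤ ((G.potential k μ F id)⁻¹) ^ k := by
      intro F _
      have h3 : 1 ≤ G.potential k μ F id := by
        refine le_trans ?_ (le_potential k μ F id)
        rw [himg]
        have : ((stopSize k : ℕ) : ℝ) ≤ Fintype.card V := by exact_mod_cast hn
        unfold stopSize at this
        push_cast at this
        linarith
      have h4 : G.potential k μ F id ≤ Y := by
        have h5 : ((G.heavySmallSets k μ F id).card : ℝ) ≤ (G.smallSets μ).card := by
          exact_mod_cast Finset.card_le_card (Finset.filter_subset _ _)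
        have h6 : G.potential k μ F id = Fintype.card V - (2 * k ^ 3 + k) +
            k * (G.heavySmallSets k μ F id).card := by
          unfold potential
          simp
        have h7 : (0 : ℝ) ≤ 2 * k ^ 3 + k := by positivity
        rw [h6, hY]
        have := mul_le_mul_of_nonneg_left h5 (Nat.cast_nonneg (α := ℝ) k)
        linarith
      gcongr
    have h3 := (Finset.card_nsmul_le_sum _ _ _ h2).trans h1
    rw [nsmul_eq_mul, inv_pow, ← div_eq_mul_inv, div_le_iff₀ (by positivity)] at h3
    exact h3
  · have h1 := card_survives_le fun F hF => (h𝓕 F hF).2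
    rw [himg] at h1
    have h2 : (𝓕.card : ℝ) ≤ 2 ^ (stopSize k ^ 2) := by
      have : 𝓕.card ≤ 2 ^ (stopSize k ^ 2) := h1.trans (by gcongr; norm_num)
      exact_mod_cast this
    refine h2.trans (le_mul_of_one_le_right (by positivity) (one_le_pow₀ hY1))

end WGraph

/-! ### Combining the two counts. -/

namespace WGraph

variable {V ι : Type*} [Fintype ι] [Fintype V] {G : WGraph V ι}

/-- A family of light edge sets cut out by labellings has at most `n ^ k` times a power of
`log n` members. -/
lemma KCutBound.card_le {k : ℕ} {μ : ℝ} (hk : 2 ≤ k) (hμ : 0 < μ)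
    (hP : G.KCutBound k (k * μ)) {𝓕 : Finset (Finset ι)}
    (h𝓕 : ∀ F ∈ 𝓕, G.mass (· ∈ F) ≤ k * μ ∧ G.Survives id F) [Nonempty V] :
    (𝓕.card : ℝ) ≤ (Fintype.card V : ℝ) ^ k * (2 ^ (stopSize k ^ 2) *
      (1 + k * smallSetsConst k * (1 + Real.log (Fintype.card V))) ^ k) := by
  refine (hP.card_le_of_smallSets hk hμ h𝓕).trans ?_
  have h := card_smallSets_le hk hμ hP
  calc (2 : ℝ) ^ (stopSize k ^ 2) * (Fintype.card V + k * (G.smallSets μ).card : ℝ) ^ k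
      ≤ 2 ^ (stopSize k ^ 2) * (Fintype.card V + k * (smallSetsConst k *
          (Fintype.card V * (1 + Real.log (Fintype.card V)))) : ℝ) ^ k := by gcongr
    _ = _ := by
      rw [mul_left_comm ((Fintype.card V : ℝ) ^ k), ← mul_pow]
      congr 2
      ring

end WGraph

/-! ### Absorbing powers of log n. -/

/-- ln ln vanishes only at e, strictly between 2 and 3; the sign change forces the absolute value.
-/
lemma exists_le_abs_log_log :
    ∃ δ : ℝ, 0 < δ ∧ ∀ n : ℕ, 2 ≤ n → δ ≤ |Real.log (Real.log n)| := by
  have hlog2 : 0 < Real.log 2 := Real.log_pos one_lt_two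
  have hlog2' : Real.log 2 < 1 := Real.log_two_lt_d9.trans (by norm_num)
  have hlog3 : 1 < Real.log 3 := by
    rw [Real.lt_log_iff_exp_lt (by norm_num)]
    exact Real.exp_one_lt_d9.trans (by norm_num)
  have h2 : Real.log (Real.log 2) < 0 := Real.log_neg hlog2 hlog2'
  have h3 : 0 < Real.log (Real.log 3) := Real.log_pos hlog3
  refine ⟨min (-Real.log (Real.log 2)) (Real.log (Real.log 3)), lt_min (by linarith) h3,
    fun n hn => ?_⟩
  rcases hn.eq_or_lt with rfl | hn
  · push_cast
    rw [abs_of_neg h2]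
    exact min_le_left _ _
  · refine (min_le_right _ _).trans (le_trans ?_ (le_abs_self _))
    have : (3 : ℝ) ≤ n := by exact_mod_cast hn
    gcongr

/-- A power of `log n` is at most `2 ^ (C * (log log n) ^ 2)`. -/
lemma exists_polylog_le (k : ℕ) {K a : ℝ} (hK : 1 ≤ K) (ha : 0 ≤ a) :
    ∃ C : ℝ, 0 < C ∧ ∀ n : ℕ, 2 ≤ n → K * (1 + a * (1 + Real.log n)) ^ k ≤
      (2 : ℝ) ^ (C * Real.log (Real.log n) ^ 2) := by
  obtain ⟨δ, hδ, hδn⟩ := exists_le_abs_log_log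
  have hlog2 : 0 < Real.log 2 := Real.log_pos one_lt_two
  set B := K * (1 + 2 * a) ^ k with hB
  have hB1 : 1 ≤ B := one_le_mul_of_one_le_of_one_le hK (one_le_pow₀ (by linarith))
  have hA : 0 ≤ Real.log B := Real.log_nonneg hB1
  -- With L = ln ln n, the lower bound |L| ≥ δ turns both the constant ln B and the linear term k|L|
  -- into multiples of L².
  refine ⟨(Real.log B / δ ^ 2 + k / δ + 1) / Real.log 2, by positivity, fun n hn => ?_⟩
  have hn1 : (1 : ℝ) < n := by exact_mod_cast hn
  have hl := Real.log_pos hn1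
  set L := Real.log (Real.log n) with hL
  have hLδ : δ ≤ |L| := hδn n hn
  have h1 : 1 ≤ Real.exp |L| := Real.one_le_exp (abs_nonneg _)
  have h2 : Real.log n ≤ Real.exp |L| := by
    rw [← Real.exp_log hl]
    exact Real.exp_le_exp.2 (le_abs_self _)
  have h3 : 1 + a * (1 + Real.log n) ≤ (1 + 2 * a) * Real.exp |L| := by nlinarith
  have h4 : Real.log B ≤ Real.log B / δ ^ 2 * L ^ 2 := by
    rw [div_mul_eq_mul_div, le_div_iff₀ (by positivity), ← sq_abs L]
    gcongr
  have h5 : k * |L| ≤ k / δ * L ^ 2 := by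
    rw [div_mul_eq_mul_div, le_div_iff₀ hδ, ← sq_abs L, sq, mul_assoc]
    gcongr
  calc K * (1 + a * (1 + Real.log n)) ^ k
      ≤ K * ((1 + 2 * a) * Real.exp |L|) ^ k := by gcongr
    _ = Real.exp (Real.log B + k * |L|) := by
      rw [Real.exp_add, Real.exp_log (by linarith), Real.exp_nat_mul, mul_pow, hB, mul_assoc]
    _ ≤ Real.exp (Real.log 2 * ((Real.log B / δ ^ 2 + k / δ + 1) / Real.log 2 * L ^ 2)) := by
      have : Real.log 2 * ((Real.log B / δ ^ 2 + k / δ + 1) / Real.log 2 * L ^ 2) =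
          (Real.log B / δ ^ 2 + k / δ + 1) * L ^ 2 := by field_simp
      rw [this]
      gcongr
      nlinarith [sq_nonneg L]
    _ = _ := by rw [Real.rpow_def_of_pos two_pos]

/-! ### From simple graphs to weighted multigraphs. -/

namespace SimpleGraph

variable {V : Type*} (G : SimpleGraph V)

/-- The weighted multigraph with one edge for each edge of a positively weighted simple graph. -/
noncomputable def toWGraph (w : Sym2 V → ℚ) (hw : ∀ e ∈ G.edgeSet, 0 < w e) :
    WGraph V G.edgeSet where
  fst e := (Quot.out e.1).1
  snd e := (Quot.out e.1).2
  w e := w e.1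
  w_pos e := by exact_mod_cast hw e.1 e.2

variable {G} {w : Sym2 V → ℚ} {hw : ∀ e ∈ G.edgeSet, 0 < w e}

lemma mk_toWGraph_ends (e : G.edgeSet) :
    s((G.toWGraph w hw).fst e, (G.toWGraph w hw).snd e) = e.1 :=
  Quot.out_eq e.1

/-- The component of `v` after deleting `F`, as a natural number. -/
noncomputable def componentLabel [Fintype V] (G : SimpleGraph V) (F : Finset (Sym2 V)) (v : V) :
    ℕ :=
  have : Finite (G.deleteEdges (F : Set (Sym2 V))).ConnectedComponent := inferInstance
  Finite.equivFin _ ((G.deleteEdges (F : Set (Sym2 V))).connectedComponentMk v)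

lemma componentLabel_eq_iff [Fintype V] {F : Finset (Sym2 V)} {u v : V} :
    G.componentLabel F u = G.componentLabel F v ↔
      (G.deleteEdges (F : Set (Sym2 V))).Reachable u v := by
  simp [componentLabel, Fin.val_inj]

lemma card_image_componentLabel [Fintype V] (F : Finset (Sym2 V)) :
    (Finset.univ.image (G.componentLabel F)).card =
      Nat.card (G.deleteEdges (F : Set (Sym2 V))).ConnectedComponent := by
  classical
  have := Fintype.ofFinite (G.deleteEdges (F : Set (Sym2 V))).ConnectedComponent
  rw [Nat.card_eq_fintype_card, ← Finset.card_univ,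
    ← Finset.card_image_of_injective (Finset.univ :
      Finset (G.deleteEdges (F : Set (Sym2 V))).ConnectedComponent)
      (f := fun c => (Finite.equivFin _ c : ℕ))
      (fun c d hcd => by simpa [Fin.val_inj] using hcd)]
  congr 1
  ext x
  simp only [Finset.mem_image, Finset.mem_univ, true_and]
  constructor
  · rintro ⟨v, rfl⟩
    exact ⟨_, rfl⟩
  · rintro ⟨c, rfl⟩
    induction c using SimpleGraph.ConnectedComponent.ind with
    | _ v => exact ⟨v, rfl⟩

open Classical in
/-- The edges joining different classes of `g`. -/
noncomputable def crossEdges [Fintype V] (G : SimpleGraph V) (g : V → ℕ) : Finset (Sym2 V) :=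
  {e | e ∈ G.edgeSet ∧ ∃ u v, e = s(u, v) ∧ g u ≠ g v}

lemma mk_mem_crossEdges [Fintype V] {g : V → ℕ} {u v : V} :
    s(u, v) ∈ G.crossEdges g ↔ G.Adj u v ∧ g u ≠ g v := by
  simp only [crossEdges, Finset.mem_filter, Finset.mem_univ, true_and, mem_edgeSet]
  refine and_congr_right fun _ => ⟨?_, fun h => ⟨u, v, rfl, h⟩⟩
  rintro ⟨a, b, hab, h⟩
  rcases Sym2.eq_iff.1 hab with ⟨rfl, rfl⟩ | ⟨rfl, rfl⟩
  exacts [h, h.symm]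

lemma coe_mem_crossEdges [Fintype V] {g : V → ℕ} (e : G.edgeSet) :
    e.1 ∈ G.crossEdges g ↔ (G.toWGraph w hw).Cross g e := by
  have h := mk_toWGraph_ends (hw := hw) e
  have he := e.2
  rw [← h] at he ⊢
  rw [mk_mem_crossEdges]
  exact and_iff_right he

/-- Labels are constant along walks avoiding the cross edges, so there are at least as many
components as labels. -/
lemma isKCut_crossEdges [Fintype V] {k : ℕ} {g : V → ℕ} (hg : k ≤ (Finset.univ.image g).card) :
    IsKCut G k (G.crossEdges g) := by
  classical
  refine ⟨fun e he => (Finset.mem_filter.1 he).2.1, hg.trans ?_⟩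
  rw [← card_image_componentLabel]
  have hconst : ∀ u v, G.componentLabel (G.crossEdges g) u = G.componentLabel (G.crossEdges g) v →
      g u = g v := by
    intro u v huv
    obtain ⟨p⟩ := componentLabel_eq_iff.1 huv
    induction p with
    | nil => rfl
    | cons h p ih =>
      rw [deleteEdges_adj] at h
      have := fun hne => h.2 (mk_mem_crossEdges.2 ⟨h.1, hne⟩)
      rw [not_not.1 this]
      exact ih (componentLabel_eq_iff.2 ⟨p⟩)
  -- `g` factors through the component label; the value 0 is a default never used on actual labels.
  have himg : Finset.univ.image g = (Finset.univ.image (G.componentLabel (G.crossEdges g))).image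
      (fun x => if h : ∃ v, G.componentLabel (G.crossEdges g) v = x then g h.choose else 0) := by
    rw [Finset.image_image]
    refine Finset.image_congr fun v _ => ?_
    have h : ∃ u, G.componentLabel (G.crossEdges g) u = G.componentLabel (G.crossEdges g) v :=
      ⟨v, rfl⟩
    simp only [Function.comp_apply, dif_pos h]
    exact (hconst _ _ h.choose_spec).symm
  rw [himg]
  exact Finset.card_image_le

open Classical in
lemma mass_toWGraph [Fintype V] {F : Finset (Sym2 V)} (hF : (F : Set (Sym2 V)) ⊆ G.edgeSet) :
    (G.toWGraph w hw).mass (fun e => e.1 ∈ F) = ((∑ e ∈ F, w e : ℚ) : ℝ) := by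
  have : (∑ e ∈ F, w e : ℚ) = ∑ e : G.edgeSet, if e.1 ∈ F then w e.1 else 0 := by
    rw [← Finset.sum_filter, ← Finset.sum_image (s := ({e | e.1 ∈ F} : Finset G.edgeSet))
      (g := Subtype.val) (f := w) Subtype.val_injective.injOn]
    refine Finset.sum_congr ?_ fun _ _ => rfl
    ext e
    simp only [Finset.mem_image, Finset.mem_filter, Finset.mem_univ, true_and, Subtype.exists,
      exists_and_left, exists_prop, exists_eq_right_right]
    exact ⟨fun h => ⟨h, hF h⟩, fun h => h.1⟩
  rw [this, WGraph.mass]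
  push_cast
  refine Finset.sum_congr rfl fun e _ => ?_
  by_cases h : e.1 ∈ F <;> simp [h, toWGraph]

/-- A minimum `k`-cut consists of the edges between the components it leaves. -/
lemma crossEdges_componentLabel [Fintype V] (hw : ∀ e ∈ G.edgeSet, 0 < w e) {k : ℕ}
    {F : Finset (Sym2 V)} (hF : IsMinKCut G w k F) :
    G.crossEdges (G.componentLabel F) = F := by
  have hsub : G.crossEdges (G.componentLabel F) ⊆ F := by
    intro e
    induction e using Sym2.ind with
    | _ u v =>
      rw [mk_mem_crossEdges]
      rintro ⟨hadj, hne⟩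
      by_contra he
      exact hne (componentLabel_eq_iff.2 (Adj.reachable (deleteEdges_adj.2 ⟨hadj, he⟩)))
  have hcut : IsKCut G k (G.crossEdges (G.componentLabel F)) :=
    isKCut_crossEdges (by rw [card_image_componentLabel]; exact hF.1.2)
  -- An edge of F inside a component could be dropped, leaving a strictly lighter k-cut because
  -- weights are positive.
  refine hsub.antisymm fun e he => ?_
  by_contra hne
  exact (Finset.sum_lt_sum_of_subset hsub he hne (hw e (hF.1.1 he))
    fun j hj _ => (hw j (hF.1.1 hj)).le).not_ge (hF.2 _ hcut)

lemma ncard_isMinKCut_le [Fintype V] [Nonempty V] {k : ℕ} (hk : 2 ≤ k)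
    (hw : ∀ e ∈ G.edgeSet, 0 < w e) :
    (({F : Finset (Sym2 V) | IsMinKCut G w k F}.ncard : ℕ) : ℝ) ≤
      (Fintype.card V : ℝ) ^ k * (2 ^ (WGraph.stopSize k ^ 2) *
        (1 + k * WGraph.smallSetsConst k * (1 + Real.log (Fintype.card V))) ^ k) := by
  classical
  set 𝓜 : Finset (Finset (Sym2 V)) := {F | IsMinKCut G w k F} with h𝓜
  have hmem : ∀ {F}, F ∈ 𝓜 ↔ IsMinKCut G w k F := by simp [h𝓜]
  have hcoe : {F : Finset (Sym2 V) | IsMinKCut G w k F} = 𝓜 := by ext; simp [hmem]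
  rw [hcoe, Set.ncard_coe_finset]
  have hn : (1 : ℝ) ≤ Fintype.card V := by exact_mod_cast Fintype.card_pos
  have hlog := Real.log_nonneg hn
  rcases 𝓜.eq_empty_or_nonempty with h0 | ⟨F₀, hF₀⟩
  · rw [h0, Finset.card_empty, Nat.cast_zero]
    positivity
  have hmin := hmem.1 hF₀
  have hsum : ∀ F ∈ 𝓜, ∑ e ∈ F, w e = ∑ e ∈ F₀, w e := fun F hF =>
    ((hmem.1 hF).2 _ hmin.1).antisymm (hmin.2 _ (hmem.1 hF).1)
  have hk0 : (0 : ℝ) < k := by exact_mod_cast (by omega : 0 < k)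
  set lam : ℚ := ∑ e ∈ F₀, w e with hlam
  -- Minimum weight 0 is treated apart, as the counting needs μ > 0; positivity then leaves only the
  -- empty cut.
  rcases (Finset.sum_nonneg fun e he => (hw e (hmin.1.1 he)).le : 0 ≤ lam).eq_or_lt with h0 | hpos
  · have hle : 𝓜 ⊆ {∅} := by
      intro F hF
      rw [Finset.mem_singleton, Finset.eq_empty_iff_forall_notMem]
      intro e he
      have := Finset.single_le_sum (f := w)
        (fun e he => (hw e ((hmem.1 hF).1.1 he)).le) he
      rw [hsum F hF, hlam, ← h0] at this
      exact this.not_gt (hw e ((hmem.1 hF).1.1 he))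
    have h1 : (𝓜.card : ℝ) ≤ 1 := by exact_mod_cast Finset.card_le_card hle
    have h2 : (0 : ℝ) ≤ k * WGraph.smallSetsConst k * (1 + Real.log (Fintype.card V)) := by positivity
    exact h1.trans (one_le_mul_of_one_le_of_one_le (one_le_pow₀ hn)
      (one_le_mul_of_one_le_of_one_le (one_le_pow₀ one_le_two) (one_le_pow₀ (by linarith))))
  set H := G.toWGraph w hw with hH
  have hkμ : (k : ℝ) * (lam / k) = lam := by field_simp
  have hP : H.KCutBound k (k * (lam / k)) := by
    intro g hg
    have hcut := isKCut_crossEdges (G := G) hg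
    rw [hkμ]
    have h1 : (lam : ℝ) ≤ ((∑ e ∈ G.crossEdges g, w e : ℚ) : ℝ) := by
      exact_mod_cast hmin.2 _ hcut
    rw [← mass_toWGraph (hw := hw) hcut.1] at h1
    exact h1.trans_eq (H.mass_congr fun e => coe_mem_crossEdges e)
  have hμ : (0 : ℝ) < lam / k := div_pos (by exact_mod_cast hpos) hk0
  have hcard : (𝓜.image fun F => ({e | e.1 ∈ F} : Finset G.edgeSet)).card = 𝓜.card := by
    refine Finset.card_image_of_injOn fun F hF F' hF' hFF' => ?_
    ext e
    have h1 := (hmem.1 hF).1.1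
    have h2 := (hmem.1 hF').1.1
    refine ⟨fun he => ?_, fun he => ?_⟩
    · have := (Finset.ext_iff.1 hFF' ⟨e, h1 he⟩).1 (by simpa using he)
      simpa using this
    · have := (Finset.ext_iff.1 hFF' ⟨e, h2 he⟩).2 (by simpa using he)
      simpa using this
  rw [← hcard]
  refine hP.card_le hk hμ fun F' hF' => ?_
  obtain ⟨F, hF, rfl⟩ := Finset.mem_image.1 hF'
  have hF := hmem.1 hF
  refine ⟨?_, G.componentLabel F, fun e => ?_, fun u v huv => by rw [id] at huv; rw [huv]; rfl⟩
  · rw [hkμ, ← hsum F (hmem.2 hF), ← mass_toWGraph (hw := hw) hF.1.1]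
    exact (H.mass_congr fun e => by simp).le
  · rw [← coe_mem_crossEdges, crossEdges_componentLabel hw hF]
    simp

end SimpleGraph

theorem mainTheorem2 (k : ℕ) (hk : 2 ≤ k) :
    ∃ C : ℝ, 0 < C ∧
      ∀ (V : Type*) [Fintype V] (G : SimpleGraph V) (w : Sym2 V → ℚ),
        2 ≤ Fintype.card V →
        (∀ e ∈ G.edgeSet, 0 < w e) →
        (({F : Finset (Sym2 V) | IsMinKCut G w k F}.ncard : ℕ) : ℝ) ≤
          (Fintype.card V : ℝ) ^ k *
            (2 : ℝ) ^ (C * (Real.log (Real.log (Fintype.card V : ℝ))) ^ 2) := by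
  obtain ⟨C, hC, h⟩ := exists_polylog_le k (K := 2 ^ (WGraph.stopSize k ^ 2))
    (a := k * WGraph.smallSetsConst k) (one_le_pow₀ one_le_two) (by positivity)
  refine ⟨C, hC, fun V _ G w hn hw => ?_⟩
  have : Nonempty V := Fintype.card_pos_iff.1 (by omega)
  refine (SimpleGraph.ncard_isMinKCut_le hk hw).trans ?_
  gcongr
  exact h _ hn
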